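/- Let $M$ be a Hausdorff $C^2$ manifold without boundary, modelled on a finite-dimensional real vector space, and let $g$ be a semi-Riemannian metric on $M$ (a symmetric nondegenerate $(0,2)$-tensor field, of any signature) whose coefficients in the charts of the atlas are $C^1$ with locally Lipschitz first derivatives. Let $\Omega\subset M$ be a $C^2$ open subset, that is, $\Omega$ is open and there is a $C^2$ function $\phi:M\to\mathbb R$ having $0$ as a regular value, with $\phi^{-1}(0)=\partial\Omega$ and $\phi>0$ on $\Omega$; fix such a $\phi$. For $p\in\partial\Omega$ write $T_p\partial\Omega=\ker d\phi_p$, and let $H_\phi=\nabla d\phi$ be the Hessian of $\phi$ with respect to the Levi-Civita connection. We say that $\partial\Omega$ is - *infinitesimally convex* if $H_\phi(v,v)\le 0$ for all $p\in\partial\Omega$ and all $v\in T_p\partial\Omega$; *time-* (resp. *space-*) *infinitesimally convex* if this holds for all such $v$ that are timelike, $g(v,v)<0$ (resp. spacelike, $g(v,v)>0$ or $v=0$); - *locally convex* if every $p\in\partial\Omega$ has an open neighborhood $U$ such that $U\cap\Omega$ and $U\setminus\overline\Omega$ are connected and nonempty (so they are the two connected components of $U\setminus\partial\Omega$), and there is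 a neighborhood $O$ of $0$ in $T_pM$ such that $\exp_p$ is defined on $O\cap T_p\partial\Omega$ and maps it into $U\setminus\Omega=(U\cap\partial\Omega)\cup(U\setminus\overline\Omega)$; - *geometrically convex* if every geodesic arc $\gamma:[0,1]\to M$ with $\gamma(0),\gamma(1)\in\Omega$ and $\gamma([0,1])\subset\Omega\cup\partial\Omega$ satisfies $\gamma([0,1])\subset\Omega$; *time-* (resp. *space-*) *geometrically convex* if this holds for all such geodesic arcs that are timelike (resp. spacelike), i.e. whose velocity is everywhere timelike (resp. spacelike). Then local, infinitesimal and geometric convexity of $\partial\Omega$ are equivalent. Moreover, time-infinitesimal convexity of $\partial\Omega$ is equivalent to time-geometric convexity, and space-infinitesimal convexity of $\partial\Omega$ is equivalent to space-geometric convexity. -/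

import Mathlib

set_option maxSynthPendingDepth 3

open Set Filter Topology
open scoped Manifold ContDiff

noncomputable section

section

variable {E : Type*} [NormedAddCommGroup E] [NormedSpace ℝ E]
  {M : Type*} [TopologicalSpace M] [ChartedSpace E M]

/-- The expression in the chart `e` of a field `b` of bilinear forms on `M`: at the point `y` of
the target of `e` it is the pullback of `b` by `e.symm`, a bilinear form on the model space `E`. -/
def coordForm (b : ∀ x : M, TangentSpace 𝓘(ℝ, E) x →L[ℝ] TangentSpace 𝓘(ℝ, E) x →L[ℝ] ℝ)
    (e : OpenPartialHomeomorph M E) (y : E) : E →L[ℝ] E →L[ℝ] ℝ :=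
  let B : E →L[ℝ] E →L[ℝ] ℝ := b (e.symm y)
  let D : E →L[ℝ] E := mfderiv 𝓘(ℝ, E) 𝓘(ℝ, E) e.symm y
  B.bilinearComp D D

variable (E M) in
/-- A semi-Riemannian metric of class `C^{1,1}`: a field of symmetric nondegenerate bilinear forms
on the tangent spaces whose coefficients, in every chart of the atlas, are continuously
differentiable with locally Lipschitz differential. There is no condition on the signature (by
continuity the index is automatically constant on each connected component). -/
structure SemiRiemannianMetric where
  /-- the bilinear form at each point -/
  form : ∀ x : M, TangentSpace 𝓘(ℝ, E) x →L[ℝ] TangentSpace 𝓘(ℝ, E) x →L[ℝ] ℝ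
  symm : ∀ (x : M) (u v : TangentSpace 𝓘(ℝ, E) x), form x u v = form x v u
  nondegenerate : ∀ (x : M) (u : TangentSpace 𝓘(ℝ, E) x), (∀ v, form x u v = 0) → u = 0
  contDiffOn : ∀ e ∈ atlas E M, ContDiffOn ℝ 1 (coordForm form e) e.target
  locallyLipschitzOn_fderiv : ∀ e ∈ atlas E M,
    LocallyLipschitzOn e.target (fderiv ℝ (coordForm form e))

namespace SemiRiemannianMetric

variable (g : SemiRiemannianMetric E M)

/-- The Christoffel symbols of the first kind in the chart `e`: the linear form
`ξ ↦ (1/2) (∂_u g(w, ξ) + ∂_w g(u, ξ) - ∂_ξ g(u, w))`, at the point `y`. -/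
def christoffelFirst (e : OpenPartialHomeomorph M E) (y u w : E) : E →L[ℝ] ℝ :=
  (1 / 2 : ℝ) • (fderiv ℝ (coordForm g.form e) y u w + fderiv ℝ (coordForm g.form e) y w u
    - ((fderiv ℝ (coordForm g.form e) y).flip u).flip w)

/-- The Christoffel symbols of the Levi-Civita connection in the chart `e`: the vector
`Γ(y)(u, w) = Γ^l_{ij}(y) u^i w^j ∂_l`, obtained by raising the index of `christoffelFirst` (the
metric, seen as a map from `E` to its dual, is invertible at each point of the target of a
chart of the manifold, in finite dimension). -/
def christoffel (e : OpenPartialHomeomorph M E) (y u w : E) : E :=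
  (coordForm g.form e y).inverse (g.christoffelFirst e y u w)

/-- The Hessian `H_φ = ∇(dφ)` at `p`, computed in the preferred chart at `p`:
`∂²φ/∂x^i∂x^j u^i w^j - ∂φ/∂x^l Γ^l_{ij} u^i w^j`. -/
def hessian (φ : M → ℝ) (p : M) (u w : TangentSpace 𝓘(ℝ, E) p) : ℝ :=
  let e := chartAt E p
  let u' : E := mfderiv 𝓘(ℝ, E) 𝓘(ℝ, E) e p u
  let w' : E := mfderiv 𝓘(ℝ, E) 𝓘(ℝ, E) e p w
  fderiv ℝ (fderiv ℝ (φ ∘ e.symm)) (e p) u' w'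
    - fderiv ℝ (φ ∘ e.symm) (e p) (g.christoffel e (e p) u' w')

/-- A tangent vector `v` is timelike if `g(v, v) < 0`. -/
def IsTimelike {p : M} (v : TangentSpace 𝓘(ℝ, E) p) : Prop := g.form p v v < 0

/-- A tangent vector `v` is spacelike if `g(v, v) > 0` or `v = 0`. -/
def IsSpacelike {p : M} (v : TangentSpace 𝓘(ℝ, E) p) : Prop := 0 < g.form p v v ∨ v = 0

end SemiRiemannianMetric

variable (E) in
/-- The velocity `γ'(t)` of a curve `γ : [0, 1] → M` (one-sided at the endpoints); the values of
`γ` outside `[0, 1]` play no role. -/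
def velocity (γ : ℝ → M) (t : ℝ) : TangentSpace 𝓘(ℝ, E) (γ t) :=
  mfderivWithin 𝓘(ℝ, ℝ) 𝓘(ℝ, E) γ (Icc 0 1) t (1 : ℝ)

namespace SemiRiemannianMetric

variable (g : SemiRiemannianMetric E M)

/-- `γ : [0, 1] → M` is an (affinely parametrized) geodesic: it is continuous and, around each
`t ∈ [0, 1]`, its expression `x` in the preferred chart at `γ t` is differentiable with a derivative
`v` that satisfies `v' + Γ(x)(v, v) = 0` at `t`. -/
def IsGeodesicArc (γ : ℝ → M) : Prop :=
  ContinuousOn γ (Icc 0 1) ∧ ∀ t ∈ Icc (0 : ℝ) 1, ∃ v : ℝ → E,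
    (∀ᶠ s in 𝓝[Icc 0 1] t, HasDerivWithinAt (chartAt E (γ t) ∘ γ) (v s) (Icc 0 1) s) ∧
    HasDerivWithinAt v (-g.christoffel (chartAt E (γ t)) (chartAt E (γ t) (γ t)) (v t) (v t))
      (Icc 0 1) t

/-- `exp_p` is defined at `v` and `exp_p(v) = q`: some geodesic on `[0, 1]` starts at `p` with
velocity `v` and ends at `q`. -/
def IsExp (p : M) (v : TangentSpace 𝓘(ℝ, E) p) (q : M) : Prop :=
  ∃ γ : ℝ → M, g.IsGeodesicArc γ ∧
    (⟨γ 0, velocity E γ 0⟩ : TangentBundle 𝓘(ℝ, E) M) = ⟨p, v⟩ ∧ γ 1 = q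

end SemiRiemannianMetric

variable (E) in
/-- `Ω` is an open set with `C²` boundary, and `φ` is a `C²` function on `M` that has `0` as a
regular value, vanishes exactly on `∂Ω`, and is positive on `Ω`. -/
structure IsC2DefiningFunction (Ω : Set M) (φ : M → ℝ) : Prop where
  isOpen : IsOpen Ω
  contMDiff : ContMDiff 𝓘(ℝ, E) 𝓘(ℝ, ℝ) 2 φ
  regular : ∀ p : M, φ p = 0 → mfderiv 𝓘(ℝ, E) 𝓘(ℝ, ℝ) φ p ≠ 0
  preimage_zero : φ ⁻¹' {0} = frontier Ω
  pos : ∀ x ∈ Ω, 0 < φ x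

variable (E) in
/-- `v` is tangent at `p` to the regular level set of `φ` through `p`. -/
def IsTangentTo (φ : M → ℝ) (p : M) (v : TangentSpace 𝓘(ℝ, E) p) : Prop :=
  mfderiv 𝓘(ℝ, E) 𝓘(ℝ, ℝ) φ p v = 0

namespace SemiRiemannianMetric

variable (g : SemiRiemannianMetric E M)

/-- Infinitesimal convexity of `∂Ω`: `H_φ` is negative semidefinite on the tangent vectors to
`∂Ω` (`φ` being positive on `Ω`). -/
def InfinitesimallyConvex (Ω : Set M) (φ : M → ℝ) : Prop :=
  ∀ p ∈ frontier Ω, ∀ v : TangentSpace 𝓘(ℝ, E) p, IsTangentTo E φ p v → g.hessian φ p v v ≤ 0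

/-- Time-infinitesimal convexity of `∂Ω`. -/
def TimeInfinitesimallyConvex (Ω : Set M) (φ : M → ℝ) : Prop :=
  ∀ p ∈ frontier Ω, ∀ v : TangentSpace 𝓘(ℝ, E) p, IsTangentTo E φ p v → g.IsTimelike v →
    g.hessian φ p v v ≤ 0

/-- Space-infinitesimal convexity of `∂Ω`. -/
def SpaceInfinitesimallyConvex (Ω : Set M) (φ : M → ℝ) : Prop :=
  ∀ p ∈ frontier Ω, ∀ v : TangentSpace 𝓘(ℝ, E) p, IsTangentTo E φ p v → g.IsSpacelike v →
    g.hessian φ p v v ≤ 0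

/-- Local convexity of `∂Ω`: each `p ∈ ∂Ω` has an open neighborhood `U` such that `U \ ∂Ω` has
exactly two connected components, `U ∩ Ω` and `U \ closure Ω`, and there is a neighborhood `O` of
`0` in `T_p M` such that `exp_p` is defined on `O ∩ T_p ∂Ω` and maps it into the union of
`U ∩ ∂Ω` with the component `U \ closure Ω`, that is, into `U \ Ω`. -/
def LocallyConvex (Ω : Set M) (φ : M → ℝ) : Prop :=
  ∀ p ∈ frontier Ω, ∃ U : Set M, IsOpen U ∧ p ∈ U ∧
    IsConnected (U ∩ Ω) ∧ IsConnected (U \ closure Ω) ∧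
    ∃ O ∈ 𝓝 (0 : TangentSpace 𝓘(ℝ, E) p), ∀ v ∈ O, IsTangentTo E φ p v →
      ∃ q ∈ U \ Ω, g.IsExp p v q

/-- Geometric convexity of `∂Ω`: a geodesic arc with endpoints in `Ω` that is contained in
`Ω ∪ ∂Ω` is contained in `Ω`. -/
def GeometricallyConvex (Ω : Set M) : Prop :=
  ∀ γ : ℝ → M, g.IsGeodesicArc γ → γ 0 ∈ Ω → γ 1 ∈ Ω →
    (∀ t ∈ Icc (0 : ℝ) 1, γ t ∈ Ω ∪ frontier Ω) → ∀ t ∈ Icc (0 : ℝ) 1, γ t ∈ Ω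

/-- Time-geometric convexity of `∂Ω`: the same condition for timelike geodesic arcs. -/
def TimeGeometricallyConvex (Ω : Set M) : Prop :=
  ∀ γ : ℝ → M, g.IsGeodesicArc γ → (∀ t ∈ Icc (0 : ℝ) 1, g.IsTimelike (velocity E γ t)) →
    γ 0 ∈ Ω → γ 1 ∈ Ω →
    (∀ t ∈ Icc (0 : ℝ) 1, γ t ∈ Ω ∪ frontier Ω) → ∀ t ∈ Icc (0 : ℝ) 1, γ t ∈ Ω

/-- Space-geometric convexity of `∂Ω`: the same condition for spacelike geodesic arcs. -/
def SpaceGeometricallyConvex (Ω : Set M) : Prop :=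
  ∀ γ : ℝ → M, g.IsGeodesicArc γ → (∀ t ∈ Icc (0 : ℝ) 1, g.IsSpacelike (velocity E γ t)) →
    γ 0 ∈ Ω → γ 1 ∈ Ω →
    (∀ t ∈ Icc (0 : ℝ) 1, γ t ∈ Ω ∪ frontier Ω) → ∀ t ∈ Icc (0 : ℝ) 1, γ t ∈ Ω

end SemiRiemannianMetric

end

end

/-! Everything rests on contact between geodesics and the hypersurface `φ = 0`. Along a geodesic,
`(φ ∘ γ)''` is the Hessian of `φ` on the velocity. If the Hessian is positive on a tangent vector
`v`, the geodesic with velocity `v` therefore lies in `Ω` for small times other than `0`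
(`exists_solution_pos_of_chartHessian_pos`). This contradicts both geometric convexity and, by
uniqueness of geodesics, local convexity.

The hard direction starts from a Hessian that is nonpositive only on vectors tangent to the
hypersurface, and must show that a geodesic leaving it tangentially stays in `φ ≤ 0` for a short
time (`exists_nhds_forall_tangent_solution_nonpos`). As `φ` is only `C²`, its second derivatives off
the hypersurface cannot be compared with those on it at a Lipschitz rate. Instead, project the
geodesic along a fixed transversal direction `e` to a curve `z` in the hypersurface, and let `f` be
the height of the geodesic over it. Then `f''` involves `d²φ` only at `z`, on the tangent vector
`z'`, where the hypothesis applies; only the geodesic spray is compared at two points, and it is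
locally Lipschitz because the metric is `C^{1,1}`. Hence `f'' ≤ C (|f| + |f'|)`, with `f` and `f'`
vanishing at the start, and `nonpos_of_second_deriv_le` gives `f ≤ 0`.

Local convexity follows from this estimate near zero velocity. For geometric convexity, an arc in
the closure that touches the boundary does so tangentially, so its contact set is closed and open to
the right, and would reach the endpoint in `Ω`. The causal versions use the same argument with an
open, scaling-invariant condition `Q` on `g(v, v)`. -/

/-! ### A second-order differential inequality. -/

/-- A function whose second derivative is at most `C (|f| + |f'|)` and that vanishes with its
derivative at `0` is nonpositive on short intervals. -/
theorem nonpos_of_second_deriv_le {f f' f'' : ℝ → ℝ} {b C : ℝ} (hC : 0 ≤ C)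
    (hCb : C * (1 + b) * b < 1)
    (hf : ∀ t ∈ Icc 0 b, HasDerivWithinAt f (f' t) (Icc 0 b) t)
    (hf' : ∀ t ∈ Icc 0 b, HasDerivWithinAt f' (f'' t) (Icc 0 b) t)
    (hf'' : ∀ t ∈ Icc 0 b, f'' t ≤ C * (|f t| + |f' t|))
    (h0 : f 0 = 0) (h0' : f' 0 = 0) : ∀ t ∈ Icc 0 b, f t ≤ 0 := by
  have key : ∀ s ∈ Icc 0 b, f' s ≤ 0 := by
    intro s hs
    by_contra! hpos
    have hb : 0 ≤ b := hs.1.trans hs.2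
    have hcont : ContinuousOn f' (Icc 0 b) := fun t ht => (hf' t ht).continuousWithinAt
    have hsub : Icc 0 s ⊆ Icc 0 b := Icc_subset_Icc_right hs.2
    obtain ⟨m, hm, hmax⟩ := isCompact_Icc.exists_isMaxOn (nonempty_Icc.2 hs.1)
      (hcont.mono hsub).abs
    set N := |f' m| with hN
    have hle : ∀ t ∈ Icc 0 s, |f' t| ≤ N := fun t ht => hmax ht
    have hN0 : 0 < N := (abs_pos.2 hpos.ne').trans_le (hle s ⟨hs.1, le_rfl⟩)
    have hfb : ∀ t ∈ Icc 0 s, |f t| ≤ b * N := by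
      intro t ht
      have := (convex_Icc 0 s).norm_image_sub_le_of_norm_hasDerivWithin_le
        (fun x hx => (hf x (hsub hx)).mono hsub) (fun x hx => hle x hx)
        (left_mem_Icc.2 hs.1) ht
      rw [h0, sub_zero, sub_zero, Real.norm_eq_abs, Real.norm_eq_abs, abs_of_nonneg ht.1] at this
      nlinarith [ht.2, hs.2]
    have hinc : ∀ t₁ ∈ Icc 0 s, ∀ t₂ ∈ Icc 0 s, t₁ ≤ t₂ →
        f' t₂ - f' t₁ ≤ C * (1 + b) * N * (t₂ - t₁) := by
      intro t₁ h₁ t₂ h₂ h₁₂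
      refine (convex_Icc 0 s).image_sub_le_mul_sub_of_deriv_le (hcont.mono hsub) ?_ ?_
        t₁ h₁ t₂ h₂ h₁₂
      · intro t ht
        exact ((hf' t (hsub (interior_subset ht))).mono (interior_subset.trans hsub)
          ).differentiableWithinAt
      · intro t ht
        have htI := interior_subset ht
        rw [interior_Icc] at ht
        have : HasDerivAt f' (f'' t) t := (hf' t (hsub htI)).hasDerivAt
          (Icc_mem_nhds ht.1 (ht.2.trans_le hs.2))
        rw [this.deriv]
        calc f'' t ≤ C * (|f t| + |f' t|) := hf'' t (hsub htI)
          _ ≤ C * (b * N + N) := by gcongr; exacts [hfb t htI, hle t htI]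
          _ = C * (1 + b) * N := by ring
    have hA : C * (1 + b) * N * b < N := by nlinarith
    have hA' : 0 ≤ C * (1 + b) * N := by positivity
    -- If `f' m = N`, then `f'` climbs by `N` from its value `0` at time `0`. If `f' m = -N`, it
    -- climbs by more than `N` up to `f' s > 0`. Both exceed the bound `hinc`, so an upper bound on
    -- `f''` alone suffices.
    rcases abs_choice (f' m) with h | h
    · have := hinc 0 (left_mem_Icc.2 hs.1) m hm hm.1
      rw [h0', sub_zero, sub_zero, ← h] at this
      nlinarith [hm.2, hs.2]
    · have := hinc m hm s (right_mem_Icc.2 hs.1) hm.2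
      nlinarith [hm.1, hs.2]
  intro t ht
  have hanti : AntitoneOn f (Icc 0 b) := by
    refine antitoneOn_of_deriv_nonpos (convex_Icc 0 b)
      (fun t ht => (hf t ht).continuousWithinAt) ?_ ?_
    · intro t ht
      exact ((hf t (interior_subset ht)).mono interior_subset).differentiableWithinAt
    · intro t ht
      have htI := interior_subset ht
      rw [interior_Icc] at ht
      rw [((hf t htI).hasDerivAt (Icc_mem_nhds ht.1 ht.2)).deriv]
      exact key t htI
  simpa [h0] using hanti (left_mem_Icc.2 (ht.1.trans ht.2)) ht ht.1

/-! ### Second-order equations with Lipschitz right-hand side. -/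

theorem lipschitzOnWith_firstOrder {E : Type*} [NormedAddCommGroup E] {S : E → E → E} {K : NNReal} {N : Set (E × E)}
    (hL : LipschitzOnWith K (Function.uncurry S) N) :
    LipschitzOnWith (max 1 K) (fun z : E × E => (z.2, -S z.1 z.2)) N := by
  refine LipschitzWith.prod_snd.lipschitzOnWith.prodMk (g := fun z : E × E => -S z.1 z.2) ?_
  intro z hz z' hz'
  simpa [edist_neg_neg, Function.uncurry] using hL hz hz'

section SecondOrder

variable {E : Type*} [NormedAddCommGroup E] [NormedSpace ℝ E]

/-- `x` solves `x'' + S(x, x') = 0` on `I`, with velocity `v`. -/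
def IsSecondOrderSol (S : E → E → E) (x v : ℝ → E) (I : Set ℝ) : Prop :=
  ∀ t ∈ I, HasDerivWithinAt x (v t) I t ∧ HasDerivWithinAt v (-S (x t) (v t)) I t

theorem IsSecondOrderSol.mono {S : E → E → E} {x v : ℝ → E} {I J : Set ℝ}
    (h : IsSecondOrderSol S x v I) (hJ : J ⊆ I) : IsSecondOrderSol S x v J :=
  fun t ht => ⟨(h t (hJ ht)).1.mono hJ, (h t (hJ ht)).2.mono hJ⟩

/-- Quadratic homogeneity of `S` in the velocity is what makes the equation invariant under affine
changes of time. -/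
theorem IsSecondOrderSol.comp_affine {S : E → E → E}
    (hS : ∀ (y : E) (c : ℝ) (w : E), S y (c • w) = c ^ 2 • S y w)
    {x v : ℝ → E} {I J : Set ℝ} (h : IsSecondOrderSol S x v I) (c d : ℝ)
    (hJ : MapsTo (fun s => c * s + d) J I) :
    IsSecondOrderSol S (fun s => x (c * s + d)) (fun s => c • v (c * s + d)) J := by
  intro s hs
  have ha : HasDerivWithinAt (fun s : ℝ => c * s + d) c J s := by
    simpa using (((hasDerivAt_id s).const_mul c).add_const d).hasDerivWithinAt
  refine ⟨(h _ (hJ hs)).1.scomp s ha hJ, ?_⟩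
  have := ((h _ (hJ hs)).2.scomp s ha hJ).const_smul c
  rw [hS]
  have e : c • c • -(S (x (c * s + d)) (v (c * s + d))) =
      -(c ^ 2 • S (x (c * s + d)) (v (c * s + d))) := by
    rw [smul_neg, smul_neg, smul_smul, sq]
  exact e ▸ this

theorem hasDerivWithinAt_Ici_of_Icc {F : Type*} [NormedAddCommGroup F] [NormedSpace ℝ F]
    {f : ℝ → F} {f' : F} {a b t : ℝ} (h : HasDerivWithinAt f f' (Icc a b) t) (ht : t ∈ Ico a b) :
    HasDerivWithinAt f f' (Ici t) t :=
  h.mono_of_mem_nhdsWithin (mem_of_superset (Icc_mem_nhdsGE ht.2) (Icc_subset_Icc_left ht.1))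

theorem hasDerivWithinAt_Iic_of_Icc {F : Type*} [NormedAddCommGroup F] [NormedSpace ℝ F]
    {f : ℝ → F} {f' : F} {a b t : ℝ} (h : HasDerivWithinAt f f' (Icc a b) t) (ht : t ∈ Ioc a b) :
    HasDerivWithinAt f f' (Iic t) t :=
  h.mono_of_mem_nhdsWithin (mem_of_superset (Icc_mem_nhdsLE ht.1) (Icc_subset_Icc_right ht.2))

/-- Two solutions near `t₀` on `[0, 1]` with the same position and velocity at `t₀` coincide near
`t₀`. -/
theorem secondOrder_eventuallyEq {S : E → E → E} {K : NNReal} {N : Set (E × E)}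
    (hL : LipschitzOnWith K (Function.uncurry S) N) {x v y w : ℝ → E} {t₀ : ℝ}
    (ht₀ : t₀ ∈ Icc (0 : ℝ) 1) (hN : N ∈ 𝓝 (x t₀, v t₀))
    (hx : ∀ᶠ s in 𝓝[Icc 0 1] t₀, HasDerivWithinAt x (v s) (Icc 0 1) s ∧
      HasDerivWithinAt v (-S (x s) (v s)) (Icc 0 1) s)
    (hy : ∀ᶠ s in 𝓝[Icc 0 1] t₀, HasDerivWithinAt y (w s) (Icc 0 1) s ∧
      HasDerivWithinAt w (-S (y s) (w s)) (Icc 0 1) s)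
    (h₀ : x t₀ = y t₀) (h₁ : v t₀ = w t₀) :
    ∀ᶠ s in 𝓝[Icc 0 1] t₀, x s = y s ∧ v s = w s := by
  have hx₀ := hx.self_of_nhdsWithin ht₀
  have hy₀ := hy.self_of_nhdsWithin ht₀
  have hxN : ∀ᶠ s in 𝓝[Icc 0 1] t₀, (x s, v s) ∈ N :=
    (hx₀.1.continuousWithinAt.prodMk hx₀.2.continuousWithinAt) hN
  have hyN : ∀ᶠ s in 𝓝[Icc 0 1] t₀, (y s, w s) ∈ N := by
    rw [h₀, h₁] at hN
    exact (hy₀.1.continuousWithinAt.prodMk hy₀.2.continuousWithinAt) hN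
  obtain ⟨ε, hε, hball⟩ := Metric.mem_nhdsWithin_iff.1
    ((hx.and hy).and (hxN.and hyN))
  refine Metric.mem_nhdsWithin_iff.2 ⟨ε, hε, fun s hs => ?_⟩
  have hL' := lipschitzOnWith_firstOrder hL
  have hmem : ∀ t ∈ uIcc t₀ s, t ∈ Metric.ball t₀ ε ∩ Icc 0 1 := fun t ht =>
    ((convex_ball t₀ ε).ordConnected.inter ordConnected_Icc).uIcc_subset
      ⟨Metric.mem_ball_self hε, ht₀⟩ hs ht
  have hgood := fun t ht => hball (hmem t ht)
  have cont : ∀ t ∈ uIcc t₀ s, ContinuousWithinAt (fun s => (x s, v s)) (uIcc t₀ s) t ∧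
      ContinuousWithinAt (fun s => (y s, w s)) (uIcc t₀ s) t := fun t ht =>
    ⟨((hgood t ht).1.1.1.continuousWithinAt.prodMk (hgood t ht).1.1.2.continuousWithinAt).mono
      fun r hr => (hmem r hr).2,
     ((hgood t ht).1.2.1.continuousWithinAt.prodMk (hgood t ht).1.2.2.continuousWithinAt).mono
      fun r hr => (hmem r hr).2⟩
  suffices (x s, v s) = (y s, w s) by simpa using this
  rcases le_total t₀ s with h | h
  · rw [uIcc_of_le h] at *
    refine ODE_solution_unique_of_mem_Icc_right (v := fun _ (z : E × E) => (z.2, -S z.1 z.2))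
      (s := fun _ => N) (K := max 1 K) (a := t₀) (b := s) (f := fun s => (x s, v s))
      (g := fun s => (y s, w s)) (fun _ _ => hL') (fun t ht => (cont t ht).1) ?_ ?_
      (fun t ht => (cont t ht).2) ?_ ?_ (by simp [h₀, h₁]) (right_mem_Icc.2 h)
    · intro t ht
      have hg := (hgood t (Ico_subset_Icc_self ht)).1.1
      have ht' : t ∈ Ico (0 : ℝ) 1 := ⟨ht₀.1.trans ht.1, ht.2.trans_le hs.2.2⟩
      exact (hasDerivWithinAt_Ici_of_Icc hg.1 ht').prodMk (hasDerivWithinAt_Ici_of_Icc hg.2 ht')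
    · exact fun t ht => (hgood t (Ico_subset_Icc_self ht)).2.1
    · intro t ht
      have hg := (hgood t (Ico_subset_Icc_self ht)).1.2
      have ht' : t ∈ Ico (0 : ℝ) 1 := ⟨ht₀.1.trans ht.1, ht.2.trans_le hs.2.2⟩
      exact (hasDerivWithinAt_Ici_of_Icc hg.1 ht').prodMk (hasDerivWithinAt_Ici_of_Icc hg.2 ht')
    · exact fun t ht => (hgood t (Ico_subset_Icc_self ht)).2.2
  · rw [uIcc_of_ge h] at *
    refine ODE_solution_unique_of_mem_Icc_left (v := fun _ (z : E × E) => (z.2, -S z.1 z.2))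
      (s := fun _ => N) (K := max 1 K) (a := s) (b := t₀) (f := fun s => (x s, v s))
      (g := fun s => (y s, w s)) (fun _ _ => hL') (fun t ht => (cont t ht).1) ?_ ?_
      (fun t ht => (cont t ht).2) ?_ ?_ (by simp [h₀, h₁]) (left_mem_Icc.2 h)
    · intro t ht
      have hg := (hgood t (Ioc_subset_Icc_self ht)).1.1
      have ht' : t ∈ Ioc (0 : ℝ) 1 := ⟨hs.2.1.trans_lt ht.1, ht.2.trans ht₀.2⟩
      exact (hasDerivWithinAt_Iic_of_Icc hg.1 ht').prodMk (hasDerivWithinAt_Iic_of_Icc hg.2 ht')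
    · exact fun t ht => (hgood t (Ioc_subset_Icc_self ht)).2.1
    · intro t ht
      have hg := (hgood t (Ioc_subset_Icc_self ht)).1.2
      have ht' : t ∈ Ioc (0 : ℝ) 1 := ⟨hs.2.1.trans_lt ht.1, ht.2.trans ht₀.2⟩
      exact (hasDerivWithinAt_Iic_of_Icc hg.1 ht').prodMk (hasDerivWithinAt_Iic_of_Icc hg.2 ht')
    · exact fun t ht => (hgood t (Ioc_subset_Icc_self ht)).2.2

/-- The Picard fixed point is sought among curves confined to the ball of radius `a`, so the
confinement comes with existence. -/
theorem IsPicardLindelof.exists_eq_hasDerivWithinAt_mem_closedBall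
    {F : Type*} [NormedAddCommGroup F] [NormedSpace ℝ F] [CompleteSpace F]
    {f : ℝ → F → F} {tmin tmax : ℝ} {t₀ : Icc tmin tmax} {x₀ x : F} {a r L K : NNReal}
    (hf : IsPicardLindelof f t₀ x₀ a r L K) (hx : x ∈ Metric.closedBall x₀ r) :
    ∃ α : ℝ → F, α t₀ = x ∧ ∀ t ∈ Icc tmin tmax,
      HasDerivWithinAt α (f t (α t)) (Icc tmin tmax) t ∧ α t ∈ Metric.closedBall x₀ a := by
  obtain ⟨α, hα⟩ := ODE.FunSpace.exists_isFixedPt_next hf hx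
  refine ⟨α.compProj, by rw [ODE.FunSpace.compProj_val, ← hα, ODE.FunSpace.next_apply₀],
    fun t ht ↦ ⟨?_, α.compProj_mem_closedBall hf.mul_max_le⟩⟩
  apply ODE.hasDerivWithinAt_picard_Icc t₀.2 hf.continuousOn_uncurry
    α.continuous_compProj.continuousOn (fun _ ht' ↦ α.compProj_mem_closedBall hf.mul_max_le)
    x ht |>.congr_of_mem _ ht
  intro t' ht'
  nth_rw 1 [← hα]
  rw [ODE.FunSpace.compProj_of_mem ht', ODE.FunSpace.next_apply]

/-- An autonomous Lipschitz vector field has, for all initial values near `z₀`, integral curves on a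
common time interval that stay in a prescribed neighborhood of `z₀`. -/
theorem exists_integralCurves_mem {F : Type*} [NormedAddCommGroup F] [NormedSpace ℝ F]
    [CompleteSpace F] {X : F → F} {K : NNReal} {z₀ : F} {W : Set F} (hW : W ∈ 𝓝 z₀)
    (hX : LipschitzOnWith K X W) {δ : ℝ} (hδ : 0 < δ) :
    ∃ ε > 0, ε ≤ δ ∧ ∃ r > 0, ∀ z ∈ Metric.closedBall z₀ r, ∃ α : ℝ → F, α 0 = z ∧
      ∀ t ∈ Icc (-ε) ε, HasDerivWithinAt α (X (α t)) (Icc (-ε) ε) t ∧ α t ∈ W := by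
  obtain ⟨a, ha, haW⟩ := Metric.nhds_basis_closedBall.mem_iff.1 hW
  set L : ℝ := K * a + ‖X z₀‖ + 1 with hL
  have hL0 : 0 < L := by positivity
  have hb : ∀ x ∈ Metric.closedBall z₀ a, ‖X x‖ ≤ L := by
    intro x hx
    have h1 : ‖X x - X z₀‖ ≤ K * ‖x - z₀‖ :=
      hX.norm_sub_le (haW hx) (mem_of_mem_nhds hW)
    have h2 : ‖x - z₀‖ ≤ a := mem_closedBall_iff_norm.1 hx
    have h3 : ‖X x‖ ≤ ‖X x - X z₀‖ + ‖X z₀‖ := norm_le_norm_sub_add _ _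
    have h4 : (K : ℝ) * ‖x - z₀‖ ≤ K * a := by gcongr
    linarith
  -- Half of the radius `a` is left to the choice of the initial value, the other half to the
  -- distance, at most `L * ε`, travelled from it.
  set ε := min δ (a / 2 / L) with hε
  have hε0 : 0 < ε := lt_min hδ (by positivity)
  refine ⟨ε, hε0, min_le_left _ _, a / 2, by positivity, fun z hz => ?_⟩
  have hpl : IsPicardLindelof (fun _ => X) (tmin := -ε) (tmax := ε)
      ⟨0, by simp [hε0.le]⟩ z₀ (.mk a ha.le) (.mk (a / 2) (by positivity)) (.mk L hL0.le) K := by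
    refine .of_time_independent hb (hX.mono haW) ?_
    have : ε * L ≤ a / 2 := (le_div_iff₀ hL0).1 (min_le_right _ _)
    simp only [NNReal.coe_mk, sub_zero, zero_sub, neg_neg, max_self]
    linarith
  obtain ⟨α, h0, hα⟩ := hpl.exists_eq_hasDerivWithinAt_mem_closedBall hz
  exact ⟨α, h0, fun t ht => ⟨(hα t ht).1, haW (hα t ht).2⟩⟩

/-- The time `ε` is common to all initial data near `(p, v₀)`; this is what defining `exp_p` on a
whole neighborhood of `0` requires. -/
theorem exists_secondOrderSol_mem [CompleteSpace E] {S : E → E → E} {K : NNReal}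
    {N W : Set (E × E)} {p v₀ : E} (hN : N ∈ 𝓝 (p, v₀))
    (hL : LipschitzOnWith K (Function.uncurry S) N) (hW : W ∈ 𝓝 (p, v₀)) {δ : ℝ} (hδ : 0 < δ) :
    ∃ ε > 0, ε ≤ δ ∧ ∃ r > 0, ∀ z ∈ Metric.closedBall (p, v₀) r, ∃ x v : ℝ → E,
      x 0 = z.1 ∧ v 0 = z.2 ∧ IsSecondOrderSol S x v (Icc (-ε) ε) ∧
      ∀ t ∈ Icc (-ε) ε, (x t, v t) ∈ W := by
  obtain ⟨ε, hε, hεδ, r, hr, H⟩ := exists_integralCurves_mem (inter_mem hN hW)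
    ((lipschitzOnWith_firstOrder hL).mono inter_subset_left) hδ
  refine ⟨ε, hε, hεδ, r, hr, fun z hz => ?_⟩
  obtain ⟨α, h0, hα⟩ := H z hz
  refine ⟨fun t => (α t).1, fun t => (α t).2, congrArg Prod.fst h0, congrArg Prod.snd h0, fun t ht => ?_,
    fun t ht => (hα t ht).2.2⟩
  have h := (hα t ht).1
  exact ⟨(hasFDerivAt_fst (𝕜 := ℝ) (E := E) (F := E)).comp_hasDerivWithinAt t h,
    (hasFDerivAt_snd (𝕜 := ℝ) (E := E) (F := E)).comp_hasDerivWithinAt t h⟩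

end SecondOrder

/-! ### Height over a regular level set and the tangency estimate. -/

section Height

variable {E : Type*} [NormedAddCommGroup E] [NormedSpace ℝ E] [CompleteSpace E]

/-- A local diffeomorphism that translates along `e` and takes the level set `φ = 0` into a
hyperplane. -/
theorem exists_straightening {φ : E → ℝ} {p : E} (hφ : ContDiffAt ℝ 2 φ p) (e : E) :
    ∃ Φ : OpenPartialHomeomorph E E, p ∈ Φ.source ∧
      (∀ x, Φ x = x - fderiv ℝ φ p x • e + φ x • e) ∧ ContDiffAt ℝ 2 Φ.symm (Φ p) := by
  set l := fderiv ℝ φ p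
  set F : E → E := fun x => x - l x • e + φ x • e
  have hF : ContDiffAt ℝ 2 F p :=
    (contDiffAt_id.sub ((l.contDiff.contDiffAt).smul contDiffAt_const)).add
      (hφ.smul contDiffAt_const)
  -- The two rank-one terms cancel at `p`, so the derivative is the identity whatever `e` is, and
  -- the inverse function theorem applies.
  have hd : HasFDerivAt F ((ContinuousLinearEquiv.refl ℝ E : E ≃L[ℝ] E) : E →L[ℝ] E) p := by
    have h1 := (hφ.differentiableAt (by norm_num)).hasFDerivAt
    have h2 := ((hasFDerivAt_id p).sub (l.hasFDerivAt.smul_const e)).add (h1.smul_const e)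
    rw [sub_add_cancel] at h2
    exact h2
  refine ⟨hF.toOpenPartialHomeomorph F hd (by norm_num), hF.mem_toOpenPartialHomeomorph_source hd
    (by norm_num), fun x => rfl, hF.to_localInverse hd (by norm_num)⟩

/-- The signed height, along `e`, over the level set `φ = 0`. -/
theorem exists_height {φ : E → ℝ} {p e : E} (hφ : ContDiffAt ℝ 2 φ p) (h0 : φ p = 0)
    (he : fderiv ℝ φ p e = 1) :
    ∃ τ : E → ℝ, τ p = 0 ∧ ContDiffAt ℝ 2 τ p ∧
      ∀ᶠ x in 𝓝 p, φ (x - τ x • e) = 0 ∧ (φ x = 0 → τ x = 0) := by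
  obtain ⟨Φ, hp, hΦ, hsymm⟩ := exists_straightening hφ e
  set l := fderiv ℝ φ p
  have hlΦ : ∀ x, l (Φ x) = φ x := fun x => by simp [hΦ, he]
  -- `P` is the projection along `e` to the hyperplane `l = 0`. Since `Φ` moves points only along
  -- `e`, `Φ.symm ∘ P` is the projection along `e` to the level set, and the height is the
  -- coefficient of the displacement.
  set P : E → E := fun x => x - l x • e
  have hlP : ∀ x, l (P x) = 0 := fun x => by simp [P, he]
  have hPp : Φ p = P p := by simp [hΦ, h0, P]
  have hPc : ContDiff ℝ 2 P := contDiff_id.sub (l.contDiff.smul contDiff_const)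
  have hτ : ∀ x, φ x = 0 → x ∈ Φ.source → Φ.symm (P x) = x := by
    intro x hx hxs
    have : P x = Φ x := by simp [hΦ, hx, P]
    rw [this, Φ.left_inv hxs]
  refine ⟨fun x => l x - l (Φ.symm (P x)), by simp [hτ p h0 hp], ?_, ?_⟩
  · rw [hPp] at hsymm
    exact l.contDiff.contDiffAt.sub
      (l.contDiff.contDiffAt.comp p (hsymm.comp p hPc.contDiffAt))
  · have ht : ∀ᶠ x in 𝓝 p, P x ∈ Φ.target :=
      hPc.continuous.continuousAt (Φ.open_target.mem_nhds (hPp ▸ Φ.map_source hp))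
    filter_upwards [ht, Φ.open_source.mem_nhds hp] with x hx hxs
    refine ⟨?_, fun h => by simp [hτ x h hxs]⟩
    set y := Φ.symm (P x)
    have hy : Φ y = P x := Φ.right_inv hx
    have hφy : φ y = 0 := by rw [← hlΦ, hy, hlP]
    have : x - (l x - l y) • e = y := by
      have h2 := hΦ y
      rw [hy, hφy, zero_smul, add_zero] at h2
      have h3 : x - l x • e = y - l y • e := h2
      rw [sub_smul, sub_sub_eq_add_sub, add_sub_right_comm, h3]
      abel
    rw [this, hφy]

/-- A regular level set separates small neighborhoods of its points into two connected sides. -/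
theorem exists_nhds_isConnected_sides {φ : E → ℝ} {p : E} (hφ : ContDiffAt ℝ 2 φ p)
    (h0 : φ p = 0) (hd : fderiv ℝ φ p ≠ 0) {V : Set E} (hV : V ∈ 𝓝 p) :
    ∃ U ⊆ V, IsOpen U ∧ p ∈ U ∧ IsConnected {x ∈ U | 0 < φ x} ∧ IsConnected {x ∈ U | φ x < 0} := by
  obtain ⟨e, he⟩ : ∃ e, fderiv ℝ φ p e = 1 := by
    obtain ⟨e', he'⟩ := DFunLike.ne_iff.1 hd
    have he'' : fderiv ℝ φ p e' ≠ 0 := he'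
    exact ⟨(fderiv ℝ φ p e')⁻¹ • e', by simp [he'']⟩
  obtain ⟨Φ, hp, hΦ, -⟩ := exists_straightening hφ e
  set l := fderiv ℝ φ p
  have hlΦ : ∀ x, l (Φ x) = φ x := fun x => by simp [hΦ, he]
  have h1 : Φ.target ∩ Φ.symm ⁻¹' (interior V) ∈ 𝓝 (Φ p) := by
    refine inter_mem (Φ.open_target.mem_nhds (Φ.map_source hp)) ?_
    refine (Φ.symm.continuousAt (Φ.map_source hp)).preimage_mem_nhds ?_
    rw [Φ.left_inv hp]
    exact isOpen_interior.mem_nhds (mem_interior_iff_mem_nhds.2 hV)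
  obtain ⟨r, hr, hball⟩ := Metric.mem_nhds_iff.1 h1
  set B := Metric.ball (Φ p) r
  -- In the straightened coordinates `φ` becomes the linear form `l`, so each side is the continuous
  -- image of a convex piece of a ball.
  have himg : ∀ s : Set ℝ, {x ∈ Φ.source ∩ Φ ⁻¹' B | φ x ∈ s} = Φ.symm '' (B ∩ l ⁻¹' s) := by
    intro s
    ext x
    constructor
    · rintro ⟨⟨hx, hxB⟩, hxs⟩
      exact ⟨Φ x, ⟨hxB, by simpa [hlΦ] using hxs⟩, Φ.left_inv hx⟩
    · rintro ⟨y, ⟨hyB, hys⟩, rfl⟩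
      have hyt := (hball hyB).1
      refine ⟨⟨Φ.map_target hyt, ?_⟩, ?_⟩
      · simpa [Φ.right_inv hyt] using hyB
      · rw [← hlΦ, Φ.right_inv hyt]
        exact hys
  have hconn : ∀ s : Set ℝ, Convex ℝ s → (∃ c, |c| < r / (‖e‖ + 1) ∧ c ∈ s) →
      IsConnected {x ∈ Φ.source ∩ Φ ⁻¹' B | φ x ∈ s} := by
    rintro s hs ⟨c, hc, hcs⟩
    rw [himg]
    refine ⟨⟨_, Φ p + c • e, ⟨?_, ?_⟩, rfl⟩, ?_⟩
    · rw [mem_ball_iff_norm, add_sub_cancel_left, norm_smul, Real.norm_eq_abs]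
      rw [lt_div_iff₀ (by positivity)] at hc
      nlinarith [abs_nonneg c, norm_nonneg e]
    · simpa [hlΦ, h0, he] using hcs
    · refine (((convex_ball _ _).inter (hs.linear_preimage l.toLinearMap)).isPreconnected).image _
        (Φ.symm.continuousOn.mono fun y hy => (hball hy.1).1)
  have hr' : 0 < r / (‖e‖ + 1) := by positivity
  refine ⟨Φ.source ∩ Φ ⁻¹' B, ?_, Φ.isOpen_inter_preimage Metric.isOpen_ball,
    ⟨hp, Metric.mem_ball_self hr⟩, ?_, ?_⟩
  · rintro x ⟨hx, hxB⟩
    have := (hball hxB).2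
    rw [mem_preimage, Φ.left_inv hx] at this
    exact interior_subset this
  · refine hconn (Ioi 0) (convex_Ioi 0) ⟨r / (‖e‖ + 1) / 2, ?_, ?_⟩
    · rw [abs_of_pos (by positivity)]; linarith
    · exact half_pos hr'
  · refine hconn (Iio 0) (convex_Iio 0) ⟨-(r / (‖e‖ + 1) / 2), ?_, ?_⟩
    · rw [abs_neg, abs_of_pos (by positivity)]; linarith
    · exact neg_lt_zero.2 (half_pos hr')

/-- If the Hessian of `φ` is nonpositive on the vectors tangent to `φ = 0` near `(p, v₀)`, then the
solutions of `x'' + S(x, x') = 0` that start tangentially to `φ = 0` stay in `φ ≤ 0`, as long as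
they and their velocities stay in some neighborhood of `(p, v₀)`, for a time independent of the
solution. -/
theorem exists_nhds_forall_tangent_solution_nonpos {φ : E → ℝ} {S : E → E → E} {p v₀ : E}
    (hφ : ContDiffAt ℝ 2 φ p) (h0 : φ p = 0) (hd : fderiv ℝ φ p ≠ 0) (hv₀ : fderiv ℝ φ p v₀ = 0)
    {K : NNReal} {N : Set (E × E)} (hN : N ∈ 𝓝 (p, v₀))
    (hL : LipschitzOnWith K (Function.uncurry S) N)
    (hconv : ∀ᶠ z : E × E in 𝓝 (p, v₀), φ z.1 = 0 → fderiv ℝ φ z.1 z.2 = 0 →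
      fderiv ℝ (fderiv ℝ φ) z.1 z.2 z.2 - fderiv ℝ φ z.1 (S z.1 z.2) ≤ 0) :
    ∃ W ∈ 𝓝 (p, v₀), ∃ δ > 0, ∀ b ≤ δ, ∀ x v : ℝ → E, IsSecondOrderSol S x v (Icc 0 b) →
      (∀ t ∈ Icc 0 b, (x t, v t) ∈ W) → φ (x 0) = 0 → fderiv ℝ φ (x 0) (v 0) = 0 →
      ∀ t ∈ Icc 0 b, φ (x t) ≤ 0 := by
  obtain ⟨e, he⟩ : ∃ e, fderiv ℝ φ p e = 1 := by
    obtain ⟨e', he'⟩ := DFunLike.ne_iff.1 hd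
    have he'' : fderiv ℝ φ p e' ≠ 0 := he'
    exact ⟨(fderiv ℝ φ p e')⁻¹ • e', by simp [he'']⟩
  obtain ⟨τ, hτ0, hτ2, hτ⟩ := exists_height hφ h0 he
  have hτd : ∀ᶠ x in 𝓝 p, DifferentiableAt ℝ τ x :=
    (hτ2.eventually (by simp)).mono fun x hx => hx.differentiableAt (by norm_num)
  have hφ2 : ∀ᶠ x in 𝓝 p, ContDiffAt ℝ 2 φ x := hφ.eventually (by simp)
  have hdφc : ContinuousAt (fderiv ℝ φ) p :=
    (hφ.fderiv_right (m := 1) (by norm_num)).continuousAt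
  set D : ℝ := ‖fderiv ℝ φ p‖ + 1 with hD
  have hκ : ∀ᶠ x in 𝓝 p, 1 / 2 < fderiv ℝ φ x e ∧ ‖fderiv ℝ φ x‖ < D := by
    refine ((hdφc.clm_apply continuousAt_const).eventually (lt_mem_nhds ?_)).and
      (hdφc.norm.eventually (gt_mem_nhds ?_))
    · simp only [he]; norm_num
    · simp [D]
  -- the projection to the level set
  set π : E → E := fun x => x - τ x • e
  have hπc : ContinuousAt π p := continuousAt_id.sub (hτ2.continuousAt.smul continuousAt_const)
  have hπp : π p = p := by simp [π, hτ0]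
  have hπt : Tendsto π (𝓝 p) (𝓝 p) := by simpa [hπp, ContinuousAt] using hπc
  -- This is `dτ(v)`: differentiating `φ ∘ π = 0` gives `dφ(v) = dτ(v) dφ(e)`, with `dφ` taken at `π
  -- x`. In this form, differentiating it along a solution needs second derivatives of `φ` only on
  -- the level set.
  set ρ : E × E → ℝ := fun z => fderiv ℝ φ (π z.1) z.2 / fderiv ℝ φ (π z.1) e
  have hρ0 : ρ (p, v₀) = 0 := by simp [ρ, hπp, hv₀]
  have hρc : ContinuousAt ρ (p, v₀) := by
    have h1 : ContinuousAt (fun z : E × E => fderiv ℝ φ (π z.1)) (p, v₀) := by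
      have : ContinuousAt (fderiv ℝ φ) (π p) := by rwa [hπp]
      exact ContinuousAt.comp (x := (p, v₀)) (g := fun y => fderiv ℝ φ (π y))
        (ContinuousAt.comp (x := p) this hπc) continuousAt_fst
    refine (h1.clm_apply continuousAt_snd).div (h1.clm_apply continuousAt_const) ?_
    simp [hπp, he]
  -- Along a solution, `Q` gives the projected point and its velocity, which is tangent to the level
  -- set. The convexity hypothesis is used at `Q z`, the Lipschitz bound between `z` and `Q z`.
  set Q : E × E → E × E := fun z => (π z.1, z.2 - ρ z • e)
  have hQt : Tendsto Q (𝓝 (p, v₀)) (𝓝 (p, v₀)) := by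
    have : ContinuousAt Q (p, v₀) :=
      (ContinuousAt.comp (x := (p, v₀)) (g := π) hπc continuousAt_fst).prodMk
        (continuousAt_snd.sub (hρc.smul continuousAt_const))
    have h2 : Q (p, v₀) = (p, v₀) := by simp [Q, hπp, hρ0]
    simpa [ContinuousAt, h2] using this
  have hfst : Tendsto (Prod.fst : E × E → E) (𝓝 (p, v₀)) (𝓝 p) := continuousAt_fst
  obtain ⟨r, hr, hball⟩ := Metric.eventually_nhds_iff_ball.1 (hκ.and hφ2)
  have hB : ∀ᶠ x in 𝓝 p, x ∈ Metric.ball p r := Metric.ball_mem_nhds p hr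
  have hW := (hfst.eventually ((hτ.eventually_nhds.and hτd).and
    ((hB.and (hπt.eventually hB))))).and
    ((hQt.eventually (hconv.and hN)).and hN)
  -- The factor `2` bounds `1 / κ`, `D` bounds `dφ`, and `K * ‖e‖` is the Lipschitz cost of
  -- replacing `(x, v)` by its projection. The time `1 / (2 * C + 2)` below forces `b ≤ 1 / 2` and
  -- `C * b < 1 / 2 + 1 / 6`, enough for `C * (1 + b) * b < 1`.
  set C : ℝ := 2 * (D * (K * ‖e‖)) with hC
  have hC0 : 0 ≤ C := by positivity
  refine ⟨_, hW, 1 / (2 * C + 2), by positivity, ?_⟩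
  intro b hb x v hsol hmem hx0 hv0
  have hb1 : b * (2 * C + 2) ≤ 1 := (le_div_iff₀ (by positivity)).1 hb
  rcases lt_or_ge b 0 with hbneg | hbpos
  · intro t ht
    linarith [ht.1, ht.2]
  set z : ℝ → E := fun t => π (x t) with hz
  set κ : ℝ → ℝ := fun t => fderiv ℝ φ (z t) e with hκdef
  set f' : ℝ → ℝ := fun t => ρ (x t, v t) with hf'
  set w : ℝ → E := fun t => v t - f' t • e with hw
  -- the facts at a time `t`
  have hτeq : ∀ t ∈ Icc 0 b, fderiv ℝ φ (z t) (v t) = fderiv ℝ τ (x t) (v t) * κ t := by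
    intro t ht
    obtain ⟨⟨⟨h1, h2⟩, h3, h4⟩, -⟩ := hmem t ht
    have h5 : HasFDerivAt (fun y => φ (π y))
        ((fderiv ℝ φ (z t)).comp (ContinuousLinearMap.id ℝ E - (fderiv ℝ τ (x t)).smulRight e))
        (x t) := by
      have h6 : HasFDerivAt π (ContinuousLinearMap.id ℝ E - (fderiv ℝ τ (x t)).smulRight e)
          (x t) := (hasFDerivAt_id _).sub (h2.hasFDerivAt.smul_const e)
      exact (((hball _ h4).2.differentiableAt (by norm_num)).hasFDerivAt).comp _ h6
    have h7 : HasFDerivAt (fun y => φ (π y)) (0 : E →L[ℝ] ℝ) (x t) :=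
      (hasFDerivAt_const (0 : ℝ) (x t)).congr_of_eventuallyEq (h1.mono fun y hy => hy.1)
    have h8 := congrArg (fun L : E →L[ℝ] ℝ => L (v t)) (h5.unique h7)
    simp at h8
    linarith
  have hκpos : ∀ t ∈ Icc 0 b, 1 / 2 < κ t ∧ ‖fderiv ℝ φ (z t)‖ < D := fun t ht =>
    (hball _ (hmem t ht).1.2.2).1
  have hf'eq : ∀ t ∈ Icc 0 b, f' t = fderiv ℝ τ (x t) (v t) := by
    intro t ht
    have : κ t ≠ 0 := by linarith [(hκpos t ht).1]
    change fderiv ℝ φ (z t) (v t) / κ t = _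
    rw [hτeq t ht, mul_div_cancel_right₀ _ this]
  have hfd : ∀ t ∈ Icc 0 b, HasDerivWithinAt (fun t => τ (x t)) (f' t) (Icc 0 b) t := by
    intro t ht
    rw [hf'eq t ht]
    exact (hmem t ht).1.1.2.hasFDerivAt.comp_hasDerivWithinAt t (hsol t ht).1
  have hzd : ∀ t ∈ Icc 0 b, HasDerivWithinAt z (w t) (Icc 0 b) t := fun t ht =>
    (hsol t ht).1.sub ((hfd t ht).smul_const e)
  have htan : ∀ t ∈ Icc 0 b, fderiv ℝ φ (z t) (w t) = 0 := by
    intro t ht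
    simp only [w, map_sub, map_smul, smul_eq_mul]
    rw [hf'eq t ht, hτeq t ht, sub_self]
  -- By the quotient rule, `dφ(v) = f' κ` at `z` merges the two second-derivative terms into the
  -- tangent expression `d²φ(w, w)`.
  set f'' : ℝ → ℝ := fun t =>
    (fderiv ℝ (fderiv ℝ φ) (z t) (w t) (w t) - fderiv ℝ φ (z t) (S (x t) (v t))) / κ t with hf''
  have hf'd : ∀ t ∈ Icc 0 b, HasDerivWithinAt f' (f'' t) (Icc 0 b) t := by
    intro t ht
    have h1 : HasDerivWithinAt (fun t => fderiv ℝ φ (z t)) (fderiv ℝ (fderiv ℝ φ) (z t) (w t))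
        (Icc 0 b) t := by
      have h2 : DifferentiableAt ℝ (fderiv ℝ φ) (z t) :=
        ((hball _ (hmem t ht).1.2.2).2.fderiv_right (m := 1) (by norm_num)).differentiableAt
          (by norm_num)
      exact h2.hasFDerivAt.comp_hasDerivWithinAt t (hzd t ht)
    have h3 := (h1.clm_apply (hsol t ht).2).div (h1.clm_apply (hasDerivWithinAt_const t _ e))
      (by linarith [(hκpos t ht).1] : κ t ≠ 0)
    have hκ0 : κ t ≠ 0 := by linarith [(hκpos t ht).1]
    refine HasDerivWithinAt.congr_deriv (f := f') h3 ?_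
    have h4 : fderiv ℝ φ (z t) (v t) = f' t * κ t := by rw [hf'eq t ht, hτeq t ht]
    have h5 : fderiv ℝ (fderiv ℝ φ) (z t) (w t) (w t) =
        fderiv ℝ (fderiv ℝ φ) (z t) (w t) (v t)
          - f' t * fderiv ℝ (fderiv ℝ φ) (z t) (w t) e := by
      have h6 : ∀ L : E →L[ℝ] ℝ, L (w t) = L (v t) - f' t * L e := fun L => by simp [w]
      exact h6 _
    simp only [map_neg, map_zero, add_zero]
    change ((fderiv ℝ (fderiv ℝ φ) (z t) (w t) (v t) + -fderiv ℝ φ (z t) (S (x t) (v t))) * κ t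
      - fderiv ℝ φ (z t) (v t) * fderiv ℝ (fderiv ℝ φ) (z t) (w t) e) / (κ t) ^ 2 =
      (fderiv ℝ (fderiv ℝ φ) (z t) (w t) (w t) - fderiv ℝ φ (z t) (S (x t) (v t))) / κ t
    rw [h4, h5]
    field_simp
    ring
  have hineq : ∀ t ∈ Icc 0 b, f'' t ≤ C * (|τ (x t)| + |f' t|) := by
    intro t ht
    obtain ⟨⟨⟨h1, h2⟩, h3, h4⟩, ⟨h5, h6⟩, h7⟩ := hmem t ht
    obtain ⟨hk1, hk2⟩ := hκpos t ht
    have hz0 : φ (z t) = 0 := h1.self_of_nhds.1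
    have h8 : fderiv ℝ (fderiv ℝ φ) (z t) (w t) (w t) - fderiv ℝ φ (z t) (S (z t) (w t)) ≤ 0 :=
      h5 hz0 (htan t ht)
    have h9 : ‖S (z t) (w t) - S (x t) (v t)‖ ≤ K * ((|τ (x t)| + |f' t|) * ‖e‖) := by
      have := hL.norm_sub_le h6 h7
      refine this.trans ?_
      gcongr
      have e1 : z t - x t = -(τ (x t) • e) := by simp [z, π]
      have e2 : w t - v t = -(f' t • e) := by simp [w]
      refine (norm_prod_le_iff (r := (|τ (x t)| + |f' t|) * ‖e‖)).2 ⟨?_, ?_⟩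
      · change ‖z t - x t‖ ≤ _
        rw [e1, norm_neg, norm_smul, Real.norm_eq_abs]
        gcongr
        linarith [abs_nonneg (f' t)]
      · change ‖w t - v t‖ ≤ _
        rw [e2, norm_neg, norm_smul, Real.norm_eq_abs]
        gcongr
        linarith [abs_nonneg (τ (x t))]
    have h10 : fderiv ℝ φ (z t) (S (z t) (w t)) - fderiv ℝ φ (z t) (S (x t) (v t)) ≤
        D * (K * ((|τ (x t)| + |f' t|) * ‖e‖)) := by
      rw [← map_sub]
      refine (Real.le_norm_self _).trans ((ContinuousLinearMap.le_opNorm _ _).trans ?_)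
      gcongr
    have hκp : 0 < κ t := by linarith
    rw [hf'', div_le_iff₀ hκp]
    have h11 : 0 ≤ D * (K * ((|τ (x t)| + |f' t|) * ‖e‖)) := by positivity
    have h12 : C * (|τ (x t)| + |f' t|) = 2 * (D * (K * ((|τ (x t)| + |f' t|) * ‖e‖))) := by
      rw [hC]; ring
    rw [h12]
    nlinarith
  have h00 : (0 : ℝ) ∈ Icc 0 b := ⟨le_rfl, hbpos⟩
  have hτx0 : τ (x 0) = 0 := (hmem 0 h00).1.1.1.self_of_nhds.2 hx0
  have hf'0 : f' 0 = 0 := by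
    have : z 0 = x 0 := by simp [z, π, hτx0]
    simp only [f', ρ]
    change fderiv ℝ φ (z 0) (v 0) / _ = 0
    rw [this, hv0, zero_div]
  have hb2 : b ≤ 1 / 2 := by nlinarith
  have hCb : C * (1 + b) * b < 1 := by
    nlinarith [mul_nonneg hC0 hbpos, mul_nonneg (mul_nonneg hC0 hbpos) hbpos]
  have hle := nonpos_of_second_deriv_le hC0 hCb hfd hf'd hineq hτx0 hf'0
  intro t ht
  obtain ⟨⟨⟨h1, h2⟩, h3, h4⟩, -⟩ := hmem t ht
  -- On the ball `φ` increases along `e`, and `x t - z t = τ (x t) • e`, so the sign of the height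
  -- passes to `φ (x t)`.
  obtain ⟨c, hc, hceq⟩ := domain_mvt (f := φ) (s := Metric.ball p r) (x := z t) (y := x t)
    (fun y hy => ((hball y hy).2.differentiableAt (by norm_num)).hasFDerivAt.hasFDerivWithinAt)
    (convex_ball p r) h4 h3
  have hz0 : φ (z t) = 0 := h1.self_of_nhds.1
  have hcB := (convex_ball p r).segment_subset h4 h3 hc
  have e1 : x t - z t = τ (x t) • e := by simp [z, π]
  rw [hz0, sub_zero, e1, map_smul, smul_eq_mul] at hceq
  rw [hceq]
  exact mul_nonpos_of_nonpos_of_nonneg (hle t ht) (by linarith [(hball c hcB).1.1])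

end Height

/-! ### Changes of chart. -/

theorem eventually_mem_transition {E M : Type*} [TopologicalSpace E] [TopologicalSpace M]
    {e e' : OpenPartialHomeomorph M E} {y : E}
    (hy : y ∈ e.target) (hy' : e.symm y ∈ e'.source) : ∀ᶠ z in 𝓝 y, z ∈ e.target ∧ e.symm z ∈ e'.source :=
  inter_mem (e.open_target.mem_nhds hy)
    ((e.symm.continuousAt hy).preimage_mem_nhds (e'.open_source.mem_nhds hy'))

section Charts

variable {E : Type*} [NormedAddCommGroup E] [NormedSpace ℝ E]
  {M : Type*} [TopologicalSpace M] [ChartedSpace E M]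

/-- The differential of a chart, as a map of the model space. -/
noncomputable def chartDeriv (e : OpenPartialHomeomorph M E) (x : M) : E →L[ℝ] E :=
  mfderiv 𝓘(ℝ, E) 𝓘(ℝ, E) e x

/-- The differential of the inverse of a chart, as a map of the model space. -/
noncomputable def chartSymmDeriv (e : OpenPartialHomeomorph M E) (y : E) : E →L[ℝ] E :=
  mfderiv 𝓘(ℝ, E) 𝓘(ℝ, E) e.symm y

/-- The metric at a point, as a bilinear form on the model space. -/
noncomputable def SemiRiemannianMetric.formAt (g : SemiRiemannianMetric E M) (x : M) :
    E →L[ℝ] E →L[ℝ] ℝ :=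
  g.form x

theorem SemiRiemannianMetric.formAt_symm (g : SemiRiemannianMetric E M) (x : M) (u w : E) :
    g.formAt x u w = g.formAt x w u := g.symm x u w

theorem coordForm_apply (g : SemiRiemannianMetric E M) (e : OpenPartialHomeomorph M E)
    (y u w : E) : coordForm g.form e y u w =
      g.formAt (e.symm y) (chartSymmDeriv e y u) (chartSymmDeriv e y w) := rfl

theorem coordForm_symm (g : SemiRiemannianMetric E M) (e : OpenPartialHomeomorph M E)
    (y u w : E) : coordForm g.form e y u w = coordForm g.form e y w u :=
  g.formAt_symm (e.symm y) _ _

variable [IsManifold 𝓘(ℝ, E) 2 M]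

theorem mdifferentiable_of_mem_atlas_two {e : OpenPartialHomeomorph M E} (he : e ∈ atlas E M) :
    e.MDifferentiable 𝓘(ℝ, E) 𝓘(ℝ, E) :=
  haveI : IsManifold 𝓘(ℝ, E) 1 M := IsManifold.of_le (n := 2) (by norm_num)
  mdifferentiable_of_mem_atlas he

theorem chartDeriv_chartSymmDeriv {e : OpenPartialHomeomorph M E} (he : e ∈ atlas E M) {y : E}
    (hy : y ∈ e.target) (u : E) : chartDeriv e (e.symm y) (chartSymmDeriv e y u) = u := by
  have h : (chartDeriv e (e.symm y)).comp (chartSymmDeriv e y) = ContinuousLinearMap.id ℝ E :=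
    (mdifferentiable_of_mem_atlas_two he).comp_symm_deriv hy
  exact DFunLike.congr_fun h u

theorem chartSymmDeriv_chartDeriv {e : OpenPartialHomeomorph M E} (he : e ∈ atlas E M) {x : M}
    (hx : x ∈ e.source) (u : E) : chartSymmDeriv e (e x) (chartDeriv e x u) = u := by
  have h : (chartSymmDeriv e (e x)).comp (chartDeriv e x) = ContinuousLinearMap.id ℝ E :=
    (mdifferentiable_of_mem_atlas_two he).symm_comp_deriv hx
  exact DFunLike.congr_fun h u

theorem contDiffAt_transition {e e' : OpenPartialHomeomorph M E} (he : e ∈ atlas E M)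
    (he' : e' ∈ atlas E M) {y : E} (hy : y ∈ e.target) (hy' : e.symm y ∈ e'.source) :
    ContDiffAt ℝ 2 (e' ∘ e.symm) y := by
  rw [← contMDiffAt_iff_contDiffAt]
  exact (contMDiffAt_of_mem_maximalAtlas (IsManifold.subset_maximalAtlas he') hy').comp y
    (contMDiffAt_symm_of_mem_maximalAtlas (IsManifold.subset_maximalAtlas he) hy)

theorem fderiv_transition {e e' : OpenPartialHomeomorph M E} (he : e ∈ atlas E M)
    (he' : e' ∈ atlas E M) {y : E} (hy : y ∈ e.target) (hy' : e.symm y ∈ e'.source) (u : E) :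
    fderiv ℝ (e' ∘ e.symm) y u = chartDeriv e' (e.symm y) (chartSymmDeriv e y u) := by
  rw [← mfderiv_eq_fderiv]
  exact congrArg (fun L : E →L[ℝ] E => L u) (mfderiv_comp y
    ((mdifferentiable_of_mem_atlas_two he').mdifferentiableAt hy')
    ((mdifferentiable_of_mem_atlas_two he).mdifferentiableAt_symm hy))

theorem chartSymmDeriv_fderiv_transition {e e' : OpenPartialHomeomorph M E} (he : e ∈ atlas E M)
    (he' : e' ∈ atlas E M) {y : E} (hy : y ∈ e.target)
    (hy' : e.symm y ∈ e'.source) (u : E) :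
    chartSymmDeriv e' (e' (e.symm y)) (fderiv ℝ (e' ∘ e.symm) y u) = chartSymmDeriv e y u := by
  rw [fderiv_transition he he' hy hy', chartSymmDeriv_chartDeriv he' hy']

theorem fderiv_transition_surjective {e e' : OpenPartialHomeomorph M E} (he : e ∈ atlas E M)
    (he' : e' ∈ atlas E M) {y : E} (hy : y ∈ e.target) (hy' : e.symm y ∈ e'.source) :
    Function.Surjective (fderiv ℝ (e' ∘ e.symm) y) := by
  intro w
  refine ⟨chartDeriv e (e.symm y) (chartSymmDeriv e' (e' (e.symm y)) w), ?_⟩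
  have h1 := chartSymmDeriv_chartDeriv he (e.map_target hy)
    (chartSymmDeriv e' (e' (e.symm y)) w)
  rw [e.right_inv hy] at h1
  have h2 := chartDeriv_chartSymmDeriv he' (e'.map_source hy') w
  rw [e'.left_inv hy'] at h2
  rw [fderiv_transition he he' hy hy', h1, h2]

theorem coordForm_transition {e e' : OpenPartialHomeomorph M E} (he : e ∈ atlas E M)
    (he' : e' ∈ atlas E M) (g : SemiRiemannianMetric E M) {y : E} (hy : y ∈ e.target)
    (hy' : e.symm y ∈ e'.source) (u w : E) :
    coordForm g.form e y u w = coordForm g.form e' (e' (e.symm y))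
      (fderiv ℝ (e' ∘ e.symm) y u) (fderiv ℝ (e' ∘ e.symm) y w) := by
  rw [coordForm_apply, coordForm_apply, e'.left_inv hy',
    chartSymmDeriv_fderiv_transition he he' hy hy', chartSymmDeriv_fderiv_transition he he' hy hy']

end Charts

/-! ### The geodesic spray: regularity and transformation law. -/

namespace SemiRiemannianMetric

variable {E : Type*} [NormedAddCommGroup E] [NormedSpace ℝ E]
  {M : Type*} [TopologicalSpace M] [ChartedSpace E M] (g : SemiRiemannianMetric E M)

/-- The quadratic part `v ↦ Γ(y)(v, v)` of the geodesic equation in the chart `e`. -/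
noncomputable def spray (e : OpenPartialHomeomorph M E) (y v : E) : E := g.christoffel e y v v

theorem christoffelFirst_self_apply (e : OpenPartialHomeomorph M E) (y v ξ : E) :
    g.christoffelFirst e y v v ξ = fderiv ℝ (coordForm g.form e) y v v ξ
      - 1 / 2 * fderiv ℝ (coordForm g.form e) y ξ v v := by
  simp only [christoffelFirst, smul_apply, sub_apply, add_apply, ContinuousLinearMap.flip_apply, smul_eq_mul]
  ring

theorem spray_smul (e : OpenPartialHomeomorph M E) (y : E) (c : ℝ) (v : E) :
    g.spray e y (c • v) = c ^ 2 • g.spray e y v := by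
  have : g.christoffelFirst e y (c • v) (c • v) = c ^ 2 • g.christoffelFirst e y v v := by
    ext ξ
    simp only [christoffelFirst_self_apply, smul_apply, map_smul, smul_eq_mul]
    ring
  simp only [spray, christoffel, this, map_smul]

theorem spray_zero (e : OpenPartialHomeomorph M E) (y : E) : g.spray e y 0 = 0 := by
  simpa using g.spray_smul e y 0 0

theorem hasFDerivAt_coordForm {e : OpenPartialHomeomorph M E} (he : e ∈ atlas E M) {y : E}
    (hy : y ∈ e.target) :
    HasFDerivAt (coordForm g.form e) (fderiv ℝ (coordForm g.form e) y) y :=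
  (((g.contDiffOn e he).contDiffAt (e.open_target.mem_nhds hy)).differentiableAt
    (by norm_num)).hasFDerivAt

variable [IsManifold 𝓘(ℝ, E) 2 M]

theorem coordForm_nondegenerate {e : OpenPartialHomeomorph M E} (he : e ∈ atlas E M) {y : E}
    (hy : y ∈ e.target) {u : E} (hu : ∀ w, coordForm g.form e y u w = 0) : u = 0 := by
  have h1 : chartSymmDeriv e y u = 0 := by
    refine g.nondegenerate (e.symm y) _ fun w => ?_
    have := hu (chartDeriv e (e.symm y) w)
    rw [coordForm_apply] at this
    have h2 := chartSymmDeriv_chartDeriv he (e.map_target hy) w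
    rw [e.right_inv hy] at h2
    rwa [h2] at this
  rw [← chartDeriv_chartSymmDeriv he hy u, h1, map_zero]

/-- Nondegeneracy gives injectivity, hence invertibility by equality of dimensions. Thus the
`inverse` in `christoffel` is a true inverse and not the default value `0`. -/
theorem exists_coordForm_eq [FiniteDimensional ℝ E] {e : OpenPartialHomeomorph M E}
    (he : e ∈ atlas E M) {y : E} (hy : y ∈ e.target) :
    ∃ L : E ≃L[ℝ] (E →L[ℝ] ℝ), (L : E →L[ℝ] E →L[ℝ] ℝ) = coordForm g.form e y := by
  have hinj : Function.Injective (coordForm g.form e y).toLinearMap := by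
    rw [← LinearMap.ker_eq_bot, LinearMap.ker_eq_bot']
    intro u hu
    exact g.coordForm_nondegenerate he hy fun w => congrArg (fun f : E →L[ℝ] ℝ => f w) hu
  have hfr : Module.finrank ℝ E = Module.finrank ℝ (E →L[ℝ] ℝ) := by
    rw [← (LinearMap.toContinuousLinearMap (𝕜 := ℝ) (E := E) (F' := ℝ)).finrank_eq]
    exact Subspace.dual_finrank_eq.symm
  refine ⟨(LinearMap.linearEquivOfInjective _ hinj hfr).toContinuousLinearEquiv, ?_⟩
  ext u w
  rfl

variable [FiniteDimensional ℝ E]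

theorem coordForm_spray {e : OpenPartialHomeomorph M E} (he : e ∈ atlas E M) {y : E}
    (hy : y ∈ e.target) (v : E) :
    coordForm g.form e y (g.spray e y v) = g.christoffelFirst e y v v := by
  obtain ⟨L, hL⟩ := g.exists_coordForm_eq he hy
  rw [spray, christoffel, ← hL, ContinuousLinearMap.inverse_equiv]
  exact L.apply_symm_apply _

/-- The spray is a polynomial `Q` in the inverse metric, which is `C¹`, the first derivatives of the
metric, and the velocity. The local Lipschitz condition on these derivatives enters here. -/
theorem exists_lipschitzOnWith_spray {e : OpenPartialHomeomorph M E} (he : e ∈ atlas E M) {y : E}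
    (hy : y ∈ e.target) (v : E) :
    ∃ K, ∃ N ∈ 𝓝 (y, v), LipschitzOnWith K (Function.uncurry (g.spray e)) N := by
  have := FiniteDimensional.complete ℝ E
  obtain ⟨L, hL⟩ := g.exists_coordForm_eq he hy
  obtain ⟨K₁, N₁, hN₁, hL₁⟩ := g.locallyLipschitzOn_fderiv e he hy
  rw [e.open_target.nhdsWithin_eq hy] at hN₁
  have hinv : ContDiffAt ℝ 1 (fun z => (coordForm g.form e z).inverse) y := by
    have h1 := contDiffAt_map_inverse (𝕜 := ℝ) (n := 1) L
    rw [hL] at h1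
    exact h1.comp y ((g.contDiffOn e he).contDiffAt (e.open_target.mem_nhds hy))
  obtain ⟨K₂, N₂, hN₂, hL₂⟩ := hinv.exists_lipschitzOnWith
  set Q : ((E →L[ℝ] ℝ) →L[ℝ] E) × (E →L[ℝ] E →L[ℝ] E →L[ℝ] ℝ) × E → E := fun a =>
    a.1 ((1 / 2 : ℝ) • (a.2.1 a.2.2 a.2.2 + a.2.1 a.2.2 a.2.2
      - ((a.2.1.flip a.2.2).flip a.2.2))) with hQ
  have hQc : ContDiff ℝ 1 Q := by
    have h1 : ContDiff ℝ 1 (fun a : ((E →L[ℝ] ℝ) →L[ℝ] E) × (E →L[ℝ] E →L[ℝ] E →L[ℝ] ℝ) × E =>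
        (ContinuousLinearMap.flipₗᵢ ℝ E E (E →L[ℝ] ℝ)) a.2.1) :=
      (LinearIsometryEquiv.contDiff _).comp (contDiff_fst.comp contDiff_snd)
    have hs : ContDiff ℝ 1 (fun a : ((E →L[ℝ] ℝ) →L[ℝ] E) × (E →L[ℝ] E →L[ℝ] E →L[ℝ] ℝ) × E =>
        a.2.2) := contDiff_snd.comp contDiff_snd
    have ht : ContDiff ℝ 1 (fun a : ((E →L[ℝ] ℝ) →L[ℝ] E) × (E →L[ℝ] E →L[ℝ] E →L[ℝ] ℝ) × E =>
        a.2.1) := contDiff_fst.comp contDiff_snd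
    have h2 := (LinearIsometryEquiv.contDiff (n := 1) (ContinuousLinearMap.flipₗᵢ ℝ E E ℝ)).comp
      (h1.clm_apply hs)
    have h3 := (ht.clm_apply hs).clm_apply hs
    exact contDiff_fst.clm_apply (((h3.add h3).sub (h2.clm_apply hs)).const_smul _)
  obtain ⟨K₃, N₃, hN₃, hL₃⟩ := hQc.contDiffAt.exists_lipschitzOnWith
    (x := ((coordForm g.form e y).inverse, fderiv ℝ (coordForm g.form e) y, v))
  set R : E × E → ((E →L[ℝ] ℝ) →L[ℝ] E) × (E →L[ℝ] E →L[ℝ] E →L[ℝ] ℝ) × E := fun a =>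
    ((coordForm g.form e a.1).inverse, fderiv ℝ (coordForm g.form e) a.1, a.2)
  have hN₁₂ : Prod.fst ⁻¹' (N₁ ∩ N₂) ∈ 𝓝 (y, v) :=
    continuousAt_fst.preimage_mem_nhds (inter_mem hN₁ hN₂)
  have hR : LipschitzOnWith (max (K₂ * 1) (max (K₁ * 1) 1)) R (Prod.fst ⁻¹' (N₁ ∩ N₂)) := by
    refine LipschitzOnWith.prodMk ?_ (LipschitzOnWith.prodMk ?_ ?_)
    · exact hL₂.comp LipschitzWith.prod_fst.lipschitzOnWith fun a ha => ha.2
    · exact hL₁.comp LipschitzWith.prod_fst.lipschitzOnWith fun a ha => ha.1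
    · exact LipschitzWith.prod_snd.lipschitzOnWith
  have hRc : R ⁻¹' N₃ ∈ 𝓝 (y, v) :=
    (hR.continuousOn.continuousAt hN₁₂).preimage_mem_nhds hN₃
  have hQR := hL₃.comp (hR.mono (inter_subset_left (t := R ⁻¹' N₃))) fun a ha => ha.2
  exact ⟨_, _, inter_mem hN₁₂ hRc, hQR⟩

/-- The transformation law of the Christoffel symbols, on the diagonal. -/
theorem spray_transition {e e' : OpenPartialHomeomorph M E} (he : e ∈ atlas E M)
    (he' : e' ∈ atlas E M) {y : E} (hy : y ∈ e.target) (hy' : e.symm y ∈ e'.source) (v : E) :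
    g.spray e' (e' (e.symm y)) (fderiv ℝ (e' ∘ e.symm) y v) =
      fderiv ℝ (e' ∘ e.symm) y (g.spray e y v)
        - fderiv ℝ (fderiv ℝ (e' ∘ e.symm)) y v v := by
  have hψ2 := contDiffAt_transition he he' hy hy'
  set ψ := e' ∘ e.symm with hψ
  have hy'' : ψ y ∈ e'.target := e'.map_source hy'
  have hψd : HasFDerivAt ψ (fderiv ℝ ψ y) y := (hψ2.differentiableAt (by norm_num)).hasFDerivAt
  have hψd2 : HasFDerivAt (fderiv ℝ ψ) (fderiv ℝ (fderiv ℝ ψ) y) y :=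
    ((hψ2.fderiv_right (m := 1) (by norm_num)).differentiableAt (by norm_num)).hasFDerivAt
  have hsymm : ∀ a b, fderiv ℝ (fderiv ℝ ψ) y a b = fderiv ℝ (fderiv ℝ ψ) y b a :=
    fun a b => hψ2.isSymmSndFDerivAt (by simp) a b
  set G := coordForm g.form e
  set G' := coordForm g.form e'
  have hGG : ∀ u w, ∀ᶠ z in 𝓝 y, G z u w = G' (ψ z) (fderiv ℝ ψ z u) (fderiv ℝ ψ z w) :=
    fun u w => (eventually_mem_transition hy hy').mono fun z hz =>
      coordForm_transition he he' g hz.1 hz.2 u w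
  have hdG : ∀ a u w, fderiv ℝ G y a u w =
      fderiv ℝ G' (ψ y) (fderiv ℝ ψ y a) (fderiv ℝ ψ y u) (fderiv ℝ ψ y w)
      + G' (ψ y) (fderiv ℝ (fderiv ℝ ψ) y a u) (fderiv ℝ ψ y w)
      + G' (ψ y) (fderiv ℝ ψ y u) (fderiv ℝ (fderiv ℝ ψ) y a w) := by
    intro a u w
    have h1 := ((g.hasFDerivAt_coordForm he hy).clm_apply (hasFDerivAt_const u y)).clm_apply
      (hasFDerivAt_const w y)
    have h2 := (((g.hasFDerivAt_coordForm he' hy'').comp y hψd).clm_apply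
      (hψd2.clm_apply (hasFDerivAt_const u y))).clm_apply
      (hψd2.clm_apply (hasFDerivAt_const w y))
    have h3 := congrArg (fun L : E →L[ℝ] ℝ => L a)
      (h1.unique (h2.congr_of_eventuallyEq (hGG u w)))
    simp at h3
    rw [h3]
    ring
  have hsymm' : ∀ a b, G' (ψ y) a b = G' (ψ y) b a := fun a b => coordForm_symm g e' _ a b
  have hS : ∀ ξ, G y (g.spray e y v) ξ = fderiv ℝ G y v v ξ - 1 / 2 * fderiv ℝ G y ξ v v := by
    intro ξ
    rw [← g.christoffelFirst_self_apply, ← g.coordForm_spray he hy]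
  have hS' : ∀ w ξ, G' (ψ y) (g.spray e' (ψ y) w) ξ =
      fderiv ℝ G' (ψ y) w w ξ - 1 / 2 * fderiv ℝ G' (ψ y) ξ w w := by
    intro w ξ
    rw [← g.christoffelFirst_self_apply, ← g.coordForm_spray he' hy'']
  -- Vectors are compared through their pairings with `dψ(ξ)`, which exhaust the space. In the
  -- Koszul combination the terms with `ψ''(v, ξ)` cancel by symmetry, and only `ψ''(v, v)`
  -- survives.
  rw [← sub_eq_zero]
  refine g.coordForm_nondegenerate he' hy'' fun w => ?_
  obtain ⟨ξ, rfl⟩ := fderiv_transition_surjective he he' hy hy' w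
  change G' (ψ y) (g.spray e' (ψ y) (fderiv ℝ ψ y v) - (fderiv ℝ ψ y (g.spray e y v)
    - fderiv ℝ (fderiv ℝ ψ) y v v)) (fderiv ℝ ψ y ξ) = 0
  simp only [map_sub, sub_apply]
  have h1 : G' (ψ y) (fderiv ℝ ψ y (g.spray e y v)) (fderiv ℝ ψ y ξ) = G y (g.spray e y v) ξ :=
    (hGG _ _).self_of_nhds.symm
  rw [hS', h1, hS, hdG, hdG, hsymm ξ v, hsymm' (fderiv ℝ (fderiv ℝ ψ) y v ξ)]
  ring

end SemiRiemannianMetric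

/-! ### The defining function in charts. -/

section ChartFunctions

variable {E : Type*} [NormedAddCommGroup E] [NormedSpace ℝ E]
  {M : Type*} [TopologicalSpace M] [ChartedSpace E M] [IsManifold 𝓘(ℝ, E) 2 M]

theorem contDiffAt_comp_chart_symm {φ : M → ℝ} (hφ : ContMDiff 𝓘(ℝ, E) 𝓘(ℝ, ℝ) 2 φ)
    {e : OpenPartialHomeomorph M E} (he : e ∈ atlas E M) {y : E} (hy : y ∈ e.target) :
    ContDiffAt ℝ 2 (φ ∘ e.symm) y := by
  rw [← contMDiffAt_iff_contDiffAt]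
  exact hφ.contMDiffAt.comp y
    (contMDiffAt_symm_of_mem_maximalAtlas (IsManifold.subset_maximalAtlas he) hy)

omit [IsManifold 𝓘(ℝ, E) 2 M] in
theorem IsC2DefiningFunction.mem_frontier_iff {Ω : Set M} {φ : M → ℝ}
    (h : IsC2DefiningFunction E Ω φ) {p : M} : p ∈ frontier Ω ↔ φ p = 0 := by
  rw [← h.preimage_zero]
  rfl

/-- The differential of a function on `M`, as a linear form on the model space. -/
noncomputable def scalarDeriv (φ : M → ℝ) (x : M) : E →L[ℝ] ℝ := mfderiv 𝓘(ℝ, E) 𝓘(ℝ, ℝ) φ x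

theorem fderiv_comp_chart_symm {φ : M → ℝ} (hφ : ContMDiff 𝓘(ℝ, E) 𝓘(ℝ, ℝ) 2 φ)
    {e : OpenPartialHomeomorph M E} (he : e ∈ atlas E M) {y : E} (hy : y ∈ e.target) (w : E) :
    fderiv ℝ (φ ∘ e.symm) y w =
      scalarDeriv φ (e.symm y) (chartSymmDeriv e y w) := by
  rw [← mfderiv_eq_fderiv]
  exact congrArg (fun L : E →L[ℝ] ℝ => L w) (mfderiv_comp y
    (hφ.mdifferentiable (by norm_num) _)
    ((mdifferentiable_of_mem_atlas_two he).mdifferentiableAt_symm hy))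

theorem isTangentTo_iff {φ : M → ℝ} (hφ : ContMDiff 𝓘(ℝ, E) 𝓘(ℝ, ℝ) 2 φ)
    {e : OpenPartialHomeomorph M E} (he : e ∈ atlas E M) {p : M} (hp : p ∈ e.source)
    (v : TangentSpace 𝓘(ℝ, E) p) :
    IsTangentTo E φ p v ↔ fderiv ℝ (φ ∘ e.symm) (e p) (chartDeriv e p v) = 0 := by
  have h : ∀ u : E, fderiv ℝ (φ ∘ e.symm) (e p) (chartDeriv e p u) = scalarDeriv φ p u := by
    intro u
    rw [fderiv_comp_chart_symm hφ he (e.map_source hp), chartSymmDeriv_chartDeriv he hp,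
      e.left_inv hp]
  exact iff_of_eq (congrArg (· = 0) (h v).symm)

theorem IsC2DefiningFunction.fderiv_ne_zero {Ω : Set M} {φ : M → ℝ}
    (h : IsC2DefiningFunction E Ω φ) {e : OpenPartialHomeomorph M E} (he : e ∈ atlas E M) {y : E}
    (hy : y ∈ e.target) (h0 : φ (e.symm y) = 0) : fderiv ℝ (φ ∘ e.symm) y ≠ 0 := by
  intro hzero
  refine h.regular _ h0 ?_
  ext v
  have h1 := fderiv_comp_chart_symm h.contMDiff he hy (chartDeriv e (e.symm y) v)
  have h2 := chartSymmDeriv_chartDeriv he (e.map_target hy) v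
  rw [e.right_inv hy] at h2
  rw [h2, hzero] at h1
  exact h1.symm

/-- Near a boundary point, in a chart, there are small neighborhoods in which `Ω` is the side
`φ > 0`, and both sides are connected. -/
theorem IsC2DefiningFunction.exists_nhds_sides {Ω : Set M} {φ : M → ℝ}
    (h : IsC2DefiningFunction E Ω φ) [CompleteSpace E]
    {e : OpenPartialHomeomorph M E} (he : e ∈ atlas E M) {y : E}
    (hy : y ∈ e.target) (h0 : φ (e.symm y) = 0) :
    ∃ U ⊆ e.target, IsOpen U ∧ y ∈ U ∧ IsConnected {z ∈ U | 0 < φ (e.symm z)} ∧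
      IsConnected {z ∈ U | φ (e.symm z) < 0} ∧ ∀ z ∈ U, 0 < φ (e.symm z) → e.symm z ∈ Ω := by
  obtain ⟨U, hUe, hUo, hyU, hpos, hneg⟩ := exists_nhds_isConnected_sides
    (contDiffAt_comp_chart_symm h.contMDiff he hy) h0 (h.fderiv_ne_zero he hy h0)
    (e.open_target.mem_nhds hy)
  refine ⟨U, hUe, hUo, hyU, hpos, hneg, fun z hz hzpos => ?_⟩
  set A := {z ∈ U | 0 < φ (e.symm z)}
  have hA : IsPreconnected (e.symm '' A) :=
    hpos.isPreconnected.image _ (e.symm.continuousOn.mono fun z hz => hUe hz.1)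
  by_contra hzΩ
  have hopen : IsOpen (e.symm '' U) := e.symm.isOpen_image_of_subset_source hUo hUe
  have hcl : e.symm y ∈ closure Ω := frontier_subset_closure (h.mem_frontier_iff.2 h0)
  obtain ⟨_, ⟨z', hz', rfl⟩, hz'Ω⟩ := mem_closure_iff.1 hcl _ hopen (mem_image_of_mem _ hyU)
  -- Positivity of `φ` does not by itself give membership in `Ω`. But `A` misses `∂Ω`, so `Ω` and
  -- the exterior split the connected image of `A`, and `Ω` meets it because the point is in
  -- `closure Ω`.
  have hsplit : ∀ w ∈ A, e.symm w ∉ Ω → e.symm w ∉ closure Ω := by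
    intro w hw hwΩ
    rw [closure_eq_self_union_frontier]
    rintro (hw' | hw')
    · exact hwΩ hw'
    · exact hw.2.ne' (h.mem_frontier_iff.1 hw')
  obtain ⟨x, -, hxΩ, hxc⟩ := hA Ω (closure Ω)ᶜ h.isOpen isClosed_closure.isOpen_compl
    (by rintro _ ⟨w, hw, rfl⟩; exact or_iff_not_imp_left.2 (hsplit w hw))
    ⟨_, ⟨z', ⟨hz', h.pos _ hz'Ω⟩, rfl⟩, hz'Ω⟩
    ⟨_, ⟨z, ⟨hz, hzpos⟩, rfl⟩, hsplit z ⟨hz, hzpos⟩ hzΩ⟩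
  exact hxc (subset_closure hxΩ)

omit [IsManifold 𝓘(ℝ, E) 2 M] in
theorem IsC2DefiningFunction.notMem_closure {Ω : Set M} {φ : M → ℝ}
    (h : IsC2DefiningFunction E Ω φ) {x : M} (hx : φ x < 0) : x ∉ closure Ω := by
  rw [closure_eq_self_union_frontier]
  rintro (hx' | hx')
  · linarith [h.pos x hx']
  · linarith [h.mem_frontier_iff.1 hx']

end ChartFunctions

/-! ### The Hessian in charts. -/

namespace SemiRiemannianMetric

variable {E : Type*} [NormedAddCommGroup E] [NormedSpace ℝ E]
  {M : Type*} [TopologicalSpace M] [ChartedSpace E M] (g : SemiRiemannianMetric E M)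

/-- The quadratic form of the Hessian of `φ` in the chart `e`. -/
noncomputable def chartHessian (φ : M → ℝ) (e : OpenPartialHomeomorph M E) (y w : E) : ℝ :=
  fderiv ℝ (fderiv ℝ (φ ∘ e.symm)) y w w - fderiv ℝ (φ ∘ e.symm) y (g.spray e y w)

theorem hessian_self (φ : M → ℝ) (p : M) (u : TangentSpace 𝓘(ℝ, E) p) :
    g.hessian φ p u u =
      g.chartHessian φ (chartAt E p) (chartAt E p p) (chartDeriv (chartAt E p) p u) := rfl

theorem chartHessian_zero (φ : M → ℝ) (e : OpenPartialHomeomorph M E) (y : E) :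
    g.chartHessian φ e y 0 = 0 := by
  simp [chartHessian, spray_zero]

variable [IsManifold 𝓘(ℝ, E) 2 M] [FiniteDimensional ℝ E]

/-- The chain rule and the transformation law of the spray both produce `dφ(ψ''(w, w))`, and these
cancel. -/
theorem chartHessian_transition {φ : M → ℝ} (hφ : ContMDiff 𝓘(ℝ, E) 𝓘(ℝ, ℝ) 2 φ)
    {e e' : OpenPartialHomeomorph M E} (he : e ∈ atlas E M)
    (he' : e' ∈ atlas E M) {y : E} (hy : y ∈ e.target) (hy' : e.symm y ∈ e'.source) (w : E) :
    g.chartHessian φ e y w =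
      g.chartHessian φ e' (e' (e.symm y)) (fderiv ℝ (e' ∘ e.symm) y w) := by
  have hψ2 := contDiffAt_transition he he' hy hy'
  have hspray := g.spray_transition he he' hy hy' w
  have hev := eventually_mem_transition hy hy'
  set ψ := e' ∘ e.symm with hψ
  have hy'' : ψ y ∈ e'.target := e'.map_source hy'
  have hh := contDiffAt_comp_chart_symm hφ he' hy''
  have heq : ∀ z, z ∈ e.target ∧ e.symm z ∈ e'.source →
      fderiv ℝ (φ ∘ e.symm) z = (fderiv ℝ (φ ∘ e'.symm) (ψ z)).comp (fderiv ℝ ψ z) := by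
    intro z hz
    have h1 : φ ∘ e.symm =ᶠ[𝓝 z] (φ ∘ e'.symm) ∘ ψ :=
      (eventually_mem_transition hz.1 hz.2).mono fun z' hz' => by
        simp [ψ, e'.left_inv hz'.2]
    have h2 := (contDiffAt_comp_chart_symm hφ he' (e'.map_source hz.2)).differentiableAt
      (by norm_num)
    have h3 := (contDiffAt_transition he he' hz.1 hz.2).differentiableAt (by norm_num)
    rw [h1.fderiv_eq]
    exact fderiv_comp z h2 h3
  have hd2 : fderiv ℝ (fderiv ℝ (φ ∘ e.symm)) y w w =
      fderiv ℝ (fderiv ℝ (φ ∘ e'.symm)) (ψ y) (fderiv ℝ ψ y w) (fderiv ℝ ψ y w) +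
      fderiv ℝ (φ ∘ e'.symm) (ψ y) (fderiv ℝ (fderiv ℝ ψ) y w w) := by
    have hA : HasFDerivAt (fderiv ℝ (φ ∘ e'.symm)) _ (ψ y) :=
      ((hh.fderiv_right (m := 1) (by norm_num)).differentiableAt (by norm_num)).hasFDerivAt
    have hB : HasFDerivAt (fderiv ℝ ψ) _ y :=
      ((hψ2.fderiv_right (m := 1) (by norm_num)).differentiableAt (by norm_num)).hasFDerivAt
    have hψd : HasFDerivAt ψ _ y := (hψ2.differentiableAt (by norm_num)).hasFDerivAt
    have hC := ((hA.comp y hψd).clm_comp hB).congr_of_eventuallyEq (hev.mono heq)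
    rw [hC.fderiv]
    simp
    ring
  change _ - fderiv ℝ (φ ∘ e.symm) y (g.spray e y w) =
    fderiv ℝ (fderiv ℝ (φ ∘ e'.symm)) (ψ y) (fderiv ℝ ψ y w) (fderiv ℝ ψ y w)
      - fderiv ℝ (φ ∘ e'.symm) (ψ y) (g.spray e' (ψ y) (fderiv ℝ ψ y w))
  have hs : g.spray e' (ψ y) (fderiv ℝ ψ y w) =
    fderiv ℝ ψ y (g.spray e y w) - fderiv ℝ (fderiv ℝ ψ) y w w := hspray
  rw [hd2, hs, heq y ⟨hy, hy'⟩, map_sub, ContinuousLinearMap.comp_apply]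
  ring

theorem chartHessian_eq_hessian {φ : M → ℝ} (hφ : ContMDiff 𝓘(ℝ, E) 𝓘(ℝ, ℝ) 2 φ)
    {e : OpenPartialHomeomorph M E} (he : e ∈ atlas E M) {y : E} (hy : y ∈ e.target) (w : E) :
    g.chartHessian φ e y w =
      g.hessian φ (e.symm y) (chartSymmDeriv e y w) (chartSymmDeriv e y w) := by
  refine Eq.trans ?_ (g.hessian_self φ (e.symm y) (chartSymmDeriv e y w)).symm
  rw [g.chartHessian_transition hφ he (chart_mem_atlas E (e.symm y)) hy
    (mem_chart_source E (e.symm y)), fderiv_transition he (chart_mem_atlas E (e.symm y)) hy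
    (mem_chart_source E (e.symm y))]

omit [FiniteDimensional ℝ E] in
theorem formAt_eq_coordForm {e : OpenPartialHomeomorph M E} (he : e ∈ atlas E M) {p : M}
    (hp : p ∈ e.source) (v : E) :
    g.formAt p v v = coordForm g.form e (e p) (chartDeriv e p v) (chartDeriv e p v) := by
  rw [coordForm_apply, chartSymmDeriv_chartDeriv he hp, e.left_inv hp]

/-- Infinitesimal convexity on the tangent vectors `v` such that `g(v, v)` satisfies `Q`. -/
def InfinitesimallyConvexOn (Q : ℝ → Prop) (Ω : Set M) (φ : M → ℝ) : Prop :=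
  ∀ p ∈ frontier Ω, ∀ v : TangentSpace 𝓘(ℝ, E) p, IsTangentTo E φ p v → Q (g.form p v v) →
    g.hessian φ p v v ≤ 0

theorem InfinitesimallyConvexOn.chartHessian_nonpos {g : SemiRiemannianMetric E M} {Q : ℝ → Prop}
    {Ω : Set M} {φ : M → ℝ} (h : g.InfinitesimallyConvexOn Q Ω φ)
    (hφ : IsC2DefiningFunction E Ω φ) {e : OpenPartialHomeomorph M E} (he : e ∈ atlas E M)
    {y w : E} (hy : y ∈ e.target) (h0 : φ (e.symm y) = 0)
    (hw : fderiv ℝ (φ ∘ e.symm) y w = 0) (hQ : Q (coordForm g.form e y w w)) :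
    g.chartHessian φ e y w ≤ 0 := by
  rw [g.chartHessian_eq_hessian hφ.contMDiff he hy]
  refine h _ (hφ.mem_frontier_iff.2 h0) _ ?_ hQ
  rw [fderiv_comp_chart_symm hφ.contMDiff he hy] at hw
  exact hw

omit [IsManifold 𝓘(ℝ, E) 2 M] [FiniteDimensional ℝ E] in
theorem continuousAt_coordForm_self {e : OpenPartialHomeomorph M E} (he : e ∈ atlas E M) {y : E}
    (hy : y ∈ e.target) (w : E) :
    ContinuousAt (fun z : E × E => coordForm g.form e z.1 z.2 z.2) (y, w) := by
  have h1 : ContinuousAt (fun z : E × E => coordForm g.form e z.1) (y, w) :=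
    ContinuousAt.comp (x := (y, w)) (g := coordForm g.form e)
      (g.hasFDerivAt_coordForm he hy).continuousAt continuousAt_fst
  exact (h1.clm_apply continuousAt_snd).clm_apply continuousAt_snd

/-- Openness of `Q` preserves the causal character of nearby vectors. The tangency estimate needs
this, since it tests the Hessian on projected velocities. -/
theorem InfinitesimallyConvexOn.eventually_chartHessian_nonpos {g : SemiRiemannianMetric E M}
    {Q : ℝ → Prop} (hQo : IsOpen {r | Q r})
    {Ω : Set M} {φ : M → ℝ} (h : g.InfinitesimallyConvexOn Q Ω φ)
    (hφ : IsC2DefiningFunction E Ω φ) {e : OpenPartialHomeomorph M E} (he : e ∈ atlas E M)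
    {y w : E} (hy : y ∈ e.target) (hQ : Q (coordForm g.form e y w w)) :
    ∀ᶠ z : E × E in 𝓝 (y, w), (φ ∘ e.symm) z.1 = 0 → fderiv ℝ (φ ∘ e.symm) z.1 z.2 = 0 →
      g.chartHessian φ e z.1 z.2 ≤ 0 := by
  have h1 : ∀ᶠ z : E × E in 𝓝 (y, w), Q (coordForm g.form e z.1 z.2 z.2) :=
    (g.continuousAt_coordForm_self he hy w).preimage_mem_nhds (hQo.mem_nhds hQ)
  have h2 : ∀ᶠ z : E × E in 𝓝 (y, w), z.1 ∈ e.target :=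
    continuousAt_fst.preimage_mem_nhds (e.open_target.mem_nhds hy)
  filter_upwards [h1, h2] with z hz1 hz2 hz3 hz4
  exact h.chartHessian_nonpos hφ he hz2 hz3 hz4 hz1

/-- A solution of the geodesic equation that is tangent to the level set `φ = 0` in a direction of
positive Hessian stays in `φ > 0` for small times different from `0`. -/
theorem exists_solution_pos_of_chartHessian_pos {φ : M → ℝ}
    (hφ : ContMDiff 𝓘(ℝ, E) 𝓘(ℝ, ℝ) 2 φ) {e : OpenPartialHomeomorph M E} (he : e ∈ atlas E M)
    {y w : E} (hy : y ∈ e.target) (h0 : φ (e.symm y) = 0)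
    (hw : fderiv ℝ (φ ∘ e.symm) y w = 0) (hpos : 0 < g.chartHessian φ e y w)
    {W : Set (E × E)} (hW : W ∈ 𝓝 (y, w)) :
    ∃ ε > 0, ∃ x v : ℝ → E, x 0 = y ∧ v 0 = w ∧
      IsSecondOrderSol (g.spray e) x v (Icc (-ε) ε) ∧
      ∀ t ∈ Icc (-ε) ε, (x t, v t) ∈ W ∧ (t ≠ 0 → 0 < φ (e.symm (x t))) := by
  have := FiniteDimensional.complete ℝ E
  obtain ⟨K, N, hN, hL⟩ := g.exists_lipschitzOnWith_spray he hy w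
  have h2 := contDiffAt_comp_chart_symm hφ he hy
  set f := φ ∘ e.symm with hf
  have hcH : ContinuousAt (fun z : E × E => g.chartHessian φ e z.1 z.2) (y, w) := by
    have hd1 := h2.fderiv_right (m := 1) (by norm_num)
    have hd2 := hd1.fderiv_right (m := 0) (by norm_num)
    have c1 : ContinuousAt (fun z : E × E => fderiv ℝ f z.1) (y, w) :=
      ContinuousAt.comp (x := (y, w)) (g := fderiv ℝ f) hd1.continuousAt continuousAt_fst
    have c2 : ContinuousAt (fun z : E × E => fderiv ℝ (fderiv ℝ f) z.1) (y, w) :=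
      ContinuousAt.comp (x := (y, w)) (g := fderiv ℝ (fderiv ℝ f)) hd2.continuousAt
        continuousAt_fst
    exact ((c2.clm_apply continuousAt_snd).clm_apply continuousAt_snd).sub
      (c1.clm_apply (hL.continuousOn.continuousAt hN))
  have hW' : ∀ᶠ z : E × E in 𝓝 (y, w), 0 < g.chartHessian φ e z.1 z.2 ∧ z.1 ∈ e.target ∧ z ∈ W :=
    (hcH.eventually (lt_mem_nhds hpos)).and
      (inter_mem (continuousAt_fst.preimage_mem_nhds (e.open_target.mem_nhds hy)) hW)
  obtain ⟨ε, hε, -, r, hr, H⟩ := exists_secondOrderSol_mem hN hL hW' one_pos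
  obtain ⟨x, v, hx0, hv0, hsol, hmem⟩ := H (y, w) (Metric.mem_closedBall_self hr.le)
  refine ⟨ε, hε, x, v, hx0, hv0, hsol, fun t ht => ⟨(hmem t ht).2.2, fun htne => ?_⟩⟩
  set I := Icc (-ε) ε
  set f₁ : ℝ → ℝ := fun t => fderiv ℝ f (x t) (v t) with hf₁
  have hd : ∀ t ∈ I, HasDerivWithinAt (fun t => f (x t)) (f₁ t) I t := by
    intro t ht
    exact ((contDiffAt_comp_chart_symm hφ he (hmem t ht).2.1).differentiableAt
      (by norm_num)).hasFDerivAt.comp_hasDerivWithinAt t (hsol t ht).1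
  have hd' : ∀ t ∈ I, HasDerivWithinAt f₁ (g.chartHessian φ e (x t) (v t)) I t := by
    intro t ht
    have h3 : HasDerivWithinAt (fun t => fderiv ℝ f (x t)) _ I t :=
      (((contDiffAt_comp_chart_symm hφ he (hmem t ht).2.1).fderiv_right (m := 1)
        (by norm_num)).differentiableAt (by norm_num)).hasFDerivAt.comp_hasDerivWithinAt t
        (hsol t ht).1
    refine (h3.clm_apply (hsol t ht).2).congr_deriv ?_
    rw [map_neg, ← sub_eq_add_neg]
    rfl
  -- The derivative of `φ` along the solution vanishes at `0` and is strictly increasing, so `φ`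
  -- decreases to `0` before time `0` and increases from it afterwards.
  have hmono : StrictMonoOn f₁ I := by
    refine strictMonoOn_of_deriv_pos (convex_Icc _ _)
      (fun t ht => (hd' t ht).continuousWithinAt) fun t ht => ?_
    have htI := interior_subset ht
    rw [interior_Icc] at ht
    rw [((hd' t htI).hasDerivAt (Icc_mem_nhds ht.1 ht.2)).deriv]
    exact (hmem t htI).1
  have h0I : (0 : ℝ) ∈ I := ⟨by linarith, hε.le⟩
  have hf₁0 : f₁ 0 = 0 := by simp only [f₁, hx0, hv0, hw]
  have hf0 : f (x 0) = 0 := by rw [hx0]; exact h0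
  rcases lt_or_gt_of_ne htne with hneg | hgt
  · have hanti : StrictAntiOn (fun t => f (x t)) (Icc (-ε) 0) := by
      have hsub : Icc (-ε) 0 ⊆ I := Icc_subset_Icc_right hε.le
      refine strictAntiOn_of_deriv_neg (convex_Icc _ _)
        (fun t ht => ((hd t (hsub ht)).continuousWithinAt).mono hsub) fun t ht => ?_
      have htI := hsub (interior_subset ht)
      rw [interior_Icc] at ht
      rw [((hd t htI).hasDerivAt (Icc_mem_nhds ht.1 (ht.2.trans hε))).deriv, ← hf₁0]
      exact hmono htI h0I ht.2
    have := hanti ⟨ht.1, hneg.le⟩ ⟨by linarith, le_rfl⟩ hneg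
    simp only [hf0] at this
    exact this
  · have hm : StrictMonoOn (fun t => f (x t)) (Icc 0 ε) := by
      have hsub : Icc 0 ε ⊆ I := Icc_subset_Icc_left (by linarith)
      refine strictMonoOn_of_deriv_pos (convex_Icc _ _)
        (fun t ht => ((hd t (hsub ht)).continuousWithinAt).mono hsub) fun t ht => ?_
      have htI := hsub (interior_subset ht)
      rw [interior_Icc] at ht
      rw [((hd t htI).hasDerivAt (Icc_mem_nhds (by linarith [ht.1]) ht.2)).deriv, ← hf₁0]
      exact hmono h0I htI ht.1
    have := hm ⟨le_rfl, hε.le⟩ ⟨hgt.le, ht.2⟩ hgt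
    simp only [hf0] at this
    exact this

end SemiRiemannianMetric

/-! ### Velocities and geodesic arcs in charts. -/

section Velocity

variable {E : Type*} [NormedAddCommGroup E] [NormedSpace ℝ E]
  {M : Type*} [TopologicalSpace M] [ChartedSpace E M]

/-- The velocity of a curve, as a vector of the model space. -/
noncomputable def velocityVec (γ : ℝ → M) (t : ℝ) : E := velocity E γ t

theorem totalSpace_velocity_eq_iff {γ : ℝ → M} {p : M} {v : TangentSpace 𝓘(ℝ, E) p} :
    (⟨γ 0, velocity E γ 0⟩ : TangentBundle 𝓘(ℝ, E) M) = ⟨p, v⟩ ↔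
      γ 0 = p ∧ (velocityVec γ 0 : E) = v := by
  constructor
  · intro h
    exact ⟨congrArg (fun z : TangentBundle 𝓘(ℝ, E) M => z.1) h,
      congrArg (fun z : TangentBundle 𝓘(ℝ, E) M => (z.2 : E)) h⟩
  · rintro ⟨rfl, h⟩
    exact congrArg (fun u : E => (⟨γ 0, u⟩ : TangentBundle 𝓘(ℝ, E) M)) h

variable [IsManifold 𝓘(ℝ, E) 2 M]

theorem velocityVec_eq {γ : ℝ → M} {e : OpenPartialHomeomorph M E} (he : e ∈ atlas E M) {t : ℝ}
    (ht : t ∈ Icc (0 : ℝ) 1) (hc : ContinuousWithinAt γ (Icc 0 1) t) (hs : γ t ∈ e.source) {w : E}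
    (hw : HasDerivWithinAt (e ∘ γ) w (Icc 0 1) t) :
    velocityVec γ t = chartSymmDeriv e (e (γ t)) w := by
  have h1 : HasMFDerivWithinAt 𝓘(ℝ, ℝ) 𝓘(ℝ, E) (e ∘ γ) (Icc 0 1) t
      (ContinuousLinearMap.toSpanSingleton ℝ w) := hw.hasFDerivWithinAt.hasMFDerivWithinAt
  have h2 := ((mdifferentiable_of_mem_atlas_two he).mdifferentiableAt_symm
    (e.map_source hs)).hasMFDerivAt
  have h3 := h2.comp_hasMFDerivWithinAt t h1
  have hev : γ =ᶠ[𝓝[Icc 0 1] t] e.symm ∘ (e ∘ γ) := by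
    filter_upwards [hc (e.open_source.mem_nhds hs)] with s hs'
    exact (e.left_inv hs').symm
  have h4 := h3.congr_of_eventuallyEq hev (e.left_inv hs).symm
  have h5 := h4.mfderivWithin ((uniqueMDiffWithinAt_iff_uniqueDiffWithinAt).2
    (uniqueDiffOn_Icc zero_lt_one t ht))
  have h6 : velocityVec γ t = (chartSymmDeriv e (e (γ t))).comp
      (ContinuousLinearMap.toSpanSingleton ℝ w) (1 : ℝ) :=
    congrArg (fun L : ℝ →L[ℝ] E => L 1) h5
  rw [h6]
  simp

end Velocity

namespace SemiRiemannianMetric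

variable {E : Type*} [NormedAddCommGroup E] [NormedSpace ℝ E]
  {M : Type*} [TopologicalSpace M] [ChartedSpace E M] (g : SemiRiemannianMetric E M)

/-- The geodesic equation at the time `t`, in the chart `e`, for a curve on `[0, 1]` whose velocity
in the chart is `v`. -/
def IsGeodesicInChartAt (e : OpenPartialHomeomorph M E) (γ : ℝ → M) (v : ℝ → E) (t : ℝ) : Prop :=
  (∀ᶠ s in 𝓝[Icc 0 1] t, HasDerivWithinAt (e ∘ γ) (v s) (Icc 0 1) s) ∧
    HasDerivWithinAt v (-g.spray e (e (γ t)) (v t)) (Icc 0 1) t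

variable [IsManifold 𝓘(ℝ, E) 2 M] [FiniteDimensional ℝ E] {g}

/-- `IsGeodesicArc` uses a chart that changes with the time, so the equation has to be carried into
a fixed one. The term `ψ''(v, v)` from differentiating `dψ(v)` is the one in `spray_transition`. -/
theorem IsGeodesicInChartAt.transition {e e' : OpenPartialHomeomorph M E} {γ : ℝ → M} {v : ℝ → E}
    {t : ℝ} (h : g.IsGeodesicInChartAt e γ v t) (he : e ∈ atlas E M) (he' : e' ∈ atlas E M)
    (ht : t ∈ Icc (0 : ℝ) 1) (hc : ContinuousWithinAt γ (Icc 0 1) t)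
    (hs : γ t ∈ e.source) (hs' : γ t ∈ e'.source) :
    g.IsGeodesicInChartAt e' γ (fun s => fderiv ℝ (e' ∘ e.symm) (e (γ s)) (v s)) t := by
  have hsrc : ∀ᶠ s in 𝓝[Icc 0 1] t, γ s ∈ e.source ∩ e'.source :=
    hc ((e.open_source.inter e'.open_source).mem_nhds ⟨hs, hs'⟩)
  have hy : e (γ t) ∈ e.target := e.map_source hs
  have hy' : e.symm (e (γ t)) ∈ e'.source := by rwa [e.left_inv hs]
  constructor
  · filter_upwards [h.1, hsrc, eventually_eventually_nhdsWithin.2 hsrc, self_mem_nhdsWithin]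
      with s hs1 hs2 hs3 hs4
    have hys' : e.symm (e (γ s)) ∈ e'.source := by rw [e.left_inv hs2.1]; exact hs2.2
    have h0 : HasFDerivAt (e' ∘ e.symm) (fderiv ℝ (e' ∘ e.symm) (e (γ s))) ((e ∘ γ) s) :=
      ((contDiffAt_transition he he' (e.map_source hs2.1) hys').differentiableAt
        (by norm_num)).hasFDerivAt
    have h1 := h0.comp_hasDerivWithinAt s hs1
    refine h1.congr_of_eventuallyEq_of_mem (hs3.mono fun r hr => ?_) hs4
    change e' (γ r) = e' (e.symm (e (γ r)))
    rw [e.left_inv hr.1]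
  · have h2 := contDiffAt_transition he he' hy hy'
    have hd : HasFDerivAt (fderiv ℝ (e' ∘ e.symm))
        (fderiv ℝ (fderiv ℝ (e' ∘ e.symm)) (e (γ t))) ((e ∘ γ) t) :=
      ((h2.fderiv_right (m := 1) (by norm_num)).differentiableAt (by norm_num)).hasFDerivAt
    have h3 := (hd.comp_hasDerivWithinAt t (h.1.self_of_nhdsWithin ht)).clm_apply h.2
    refine h3.congr_deriv ?_
    have h4 := g.spray_transition he he' hy hy' (v t)
    rw [e.left_inv hs] at h4
    rw [h4, map_neg]
    change fderiv ℝ (fderiv ℝ (e' ∘ e.symm)) (e (γ t)) (v t) (v t) + _ = _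
    abel

/-- In any chart, a geodesic arc solves the geodesic equation. -/
theorem IsGeodesicArc.eventually_hasDerivWithinAt {γ : ℝ → M} (h : g.IsGeodesicArc γ)
    {e : OpenPartialHomeomorph M E} (he : e ∈ atlas E M) {t : ℝ} (ht : t ∈ Icc (0 : ℝ) 1)
    (hs : γ t ∈ e.source) :
    ∀ᶠ s in 𝓝[Icc 0 1] t,
      HasDerivWithinAt (e ∘ γ) (derivWithin (e ∘ γ) (Icc 0 1) s) (Icc 0 1) s ∧
      HasDerivWithinAt (derivWithin (e ∘ γ) (Icc 0 1))
        (-g.spray e ((e ∘ γ) s) (derivWithin (e ∘ γ) (Icc 0 1) s)) (Icc 0 1) s := by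
  have hsrc : ∀ᶠ s in 𝓝[Icc 0 1] t, γ s ∈ e.source := h.1 t ht (e.open_source.mem_nhds hs)
  filter_upwards [hsrc, self_mem_nhdsWithin] with s hs1 hs2
  obtain ⟨v, hv⟩ := h.2 s hs2
  have h1 : g.IsGeodesicInChartAt (chartAt E (γ s)) γ v s := hv
  have h2 := h1.transition (chart_mem_atlas E (γ s)) he hs2 (h.1 s hs2)
    (mem_chart_source E (γ s)) hs1
  -- The velocity curve in the definition depends on `s`. Read in `e`, it agrees near `s` with the
  -- derivative of `e ∘ γ`, so one velocity curve serves all times.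
  have h3 : derivWithin (e ∘ γ) (Icc 0 1) =ᶠ[𝓝[Icc 0 1] s]
      fun r => fderiv ℝ (e ∘ (chartAt E (γ s)).symm) (chartAt E (γ s) (γ r)) (v r) := by
    filter_upwards [h2.1, self_mem_nhdsWithin] with r hr hr'
    exact hr.derivWithin (uniqueDiffOn_Icc zero_lt_one r hr')
  have h4 := h3.self_of_nhdsWithin hs2
  have h5 := h2.2.congr_of_eventuallyEq_of_mem h3 hs2
  refine ⟨?_, ?_⟩
  · rw [h4]
    exact h2.1.self_of_nhdsWithin hs2
  · rw [h4]
    exact h5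

theorem IsGeodesicArc.velocityVec_eq {γ : ℝ → M} (h : g.IsGeodesicArc γ)
    {e : OpenPartialHomeomorph M E} (he : e ∈ atlas E M) {t : ℝ} (ht : t ∈ Icc (0 : ℝ) 1)
    (hs : γ t ∈ e.source) :
    velocityVec γ t = chartSymmDeriv e (e (γ t)) (derivWithin (e ∘ γ) (Icc 0 1) t) :=
  _root_.velocityVec_eq he ht (h.1 t ht) hs
    ((h.eventually_hasDerivWithinAt he ht hs).self_of_nhdsWithin ht).1

/-- A solution of the geodesic equation in a chart is a geodesic arc. -/
theorem isGeodesicArc_of_isSecondOrderSol {e : OpenPartialHomeomorph M E} (he : e ∈ atlas E M)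
    {x v : ℝ → E} (h : IsSecondOrderSol (g.spray e) x v (Icc 0 1))
    (hx : ∀ t ∈ Icc (0 : ℝ) 1, x t ∈ e.target) :
    g.IsGeodesicArc (e.symm ∘ x) ∧ ∀ t ∈ Icc (0 : ℝ) 1,
      velocityVec (e.symm ∘ x) t = chartSymmDeriv e (x t) (v t) := by
  have hc : ContinuousOn (e.symm ∘ x) (Icc 0 1) :=
    e.symm.continuousOn.comp (fun t ht => (h t ht).1.continuousWithinAt) hx
  have hsrc : ∀ t ∈ Icc (0 : ℝ) 1, (e.symm ∘ x) t ∈ e.source := fun t ht => e.map_target (hx t ht)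
  have heq : EqOn (e ∘ (e.symm ∘ x)) x (Icc 0 1) := fun t ht => e.right_inv (hx t ht)
  have hd : ∀ t ∈ Icc (0 : ℝ) 1, HasDerivWithinAt (e ∘ (e.symm ∘ x)) (v t) (Icc 0 1) t :=
    fun t ht => (h t ht).1.congr heq (heq ht)
  refine ⟨⟨hc, fun t ht => ?_⟩, fun t ht => ?_⟩
  · have h1 : g.IsGeodesicInChartAt e (e.symm ∘ x) v t := by
      refine ⟨?_, ?_⟩
      · filter_upwards [self_mem_nhdsWithin] with s hs using hd s hs
      · have h2 : e ((e.symm ∘ x) t) = x t := heq ht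
        rw [h2]
        exact (h t ht).2
    exact ⟨_, h1.transition he (chart_mem_atlas E _) ht (hc t ht) (hsrc t ht)
      (mem_chart_source E _)⟩
  · rw [_root_.velocityVec_eq he ht (hc t ht) (hsrc t ht) (hd t ht)]
    have h2 : e ((e.symm ∘ x) t) = x t := heq ht
    rw [h2]

/-- A geodesic arc is determined by its initial position and velocity. -/
theorem IsGeodesicArc.eqOn [T2Space M] {γ₁ γ₂ : ℝ → M} (h₁ : g.IsGeodesicArc γ₁)
    (h₂ : g.IsGeodesicArc γ₂) (h0 : γ₁ 0 = γ₂ 0)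
    (hv : (velocityVec γ₁ 0 : E) = velocityVec γ₂ 0) : EqOn γ₁ γ₂ (Icc 0 1) := by
  have hclosed : IsClosed ({t | γ₁ t = γ₂ t} ∩ Icc 0 1) := by
    rw [inter_comm]
    exact (h₁.1.prodMk h₂.1).preimage_isClosed_of_isClosed isClosed_Icc isClosed_diagonal
  refine hclosed.Icc_subset_of_forall_mem_nhdsGT_of_Icc_subset h0 fun t ht hsub => ?_
  have htI : t ∈ Icc (0 : ℝ) 1 := ⟨ht.1, ht.2.le⟩
  have heq : γ₁ t = γ₂ t := hsub (right_mem_Icc.2 ht.1)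
  set e := chartAt E (γ₁ t)
  have he : e ∈ atlas E M := chart_mem_atlas E _
  have hs₁ : γ₁ t ∈ e.source := mem_chart_source E _
  have hs₂ : γ₂ t ∈ e.source := heq ▸ hs₁
  have d₁ := h₁.eventually_hasDerivWithinAt he htI hs₁
  have d₂ := h₂.eventually_hasDerivWithinAt he htI hs₂
  have hvt : derivWithin (e ∘ γ₁) (Icc 0 1) t = derivWithin (e ∘ γ₂) (Icc 0 1) t := by
    rcases ht.1.eq_or_lt with h | hpos
    · subst h
      have v₁ := h₁.velocityVec_eq he htI hs₁
      have v₂ := h₂.velocityVec_eq he htI hs₂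
      rw [v₁, v₂, heq] at hv
      have h3 := congrArg (chartDeriv e (e.symm (e (γ₂ 0)))) hv
      rwa [chartDeriv_chartSymmDeriv he (e.map_source hs₂),
        chartDeriv_chartSymmDeriv he (e.map_source hs₂)] at h3
    -- For `t > 0`, agreement on `[0, t]` determines the derivative at `t` from the left.
    · have hsubI : Icc 0 t ⊆ Icc (0 : ℝ) 1 := Icc_subset_Icc_right ht.2.le
      have e₁ := (d₁.self_of_nhdsWithin htI).1.mono hsubI
      have e₂ := (d₂.self_of_nhdsWithin htI).1.mono hsubI
      have e₃ := e₂.congr (f₁ := e ∘ γ₁) (fun s hs => congrArg e (hsub hs)) (congrArg e heq)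
      exact (uniqueDiffOn_Icc hpos t (right_mem_Icc.2 ht.1)).eq_deriv _ e₁ e₃
  obtain ⟨K, N, hN, hL⟩ := g.exists_lipschitzOnWith_spray he (e.map_source hs₁)
    (derivWithin (e ∘ γ₁) (Icc 0 1) t)
  have hu := secondOrder_eventuallyEq hL htI hN d₁ d₂ (congrArg e heq) hvt
  have hle : 𝓝[>] t ≤ 𝓝[Icc 0 1] t :=
    nhdsWithin_le_iff.2 (mem_of_superset (Ioc_mem_nhdsGT ht.2)
      fun s hs => ⟨ht.1.trans hs.1.le, hs.2⟩)
  have hev : ∀ᶠ s in 𝓝[Icc 0 1] t, γ₁ s = γ₂ s := by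
    filter_upwards [hu, h₁.1 t htI (e.open_source.mem_nhds hs₁),
      h₂.1 t htI (e.open_source.mem_nhds hs₂)] with s hs hs₁' hs₂'
    exact e.injOn hs₁' hs₂' hs.1
  exact hle hev

end SemiRiemannianMetric

/-! ### Contact of geodesics with the boundary, and the equivalences. -/

namespace SemiRiemannianMetric

variable {E : Type*} [NormedAddCommGroup E] [NormedSpace ℝ E]
  {M : Type*} [TopologicalSpace M] [ChartedSpace E M] {g : SemiRiemannianMetric E M}
  [IsManifold 𝓘(ℝ, E) 2 M] [FiniteDimensional ℝ E]

/-- A geodesic arc that touches `φ = 0` tangentially at the time `t` stays in `φ ≤ 0` just after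
`t`, if the Hessian is nonpositive on the tangent vectors close to its velocity. -/
theorem IsGeodesicArc.eventually_nonpos_of_tangent {γ : ℝ → M} (h : g.IsGeodesicArc γ)
    {φ : M → ℝ} (hφ : ContMDiff 𝓘(ℝ, E) 𝓘(ℝ, ℝ) 2 φ)
    {e : OpenPartialHomeomorph M E} (he : e ∈ atlas E M) {t : ℝ} (ht : t ∈ Ico (0 : ℝ) 1)
    (hs : γ t ∈ e.source) (h0 : φ (γ t) = 0) (hd : fderiv ℝ (φ ∘ e.symm) (e (γ t)) ≠ 0)
    (hv : fderiv ℝ (φ ∘ e.symm) (e (γ t)) (derivWithin (e ∘ γ) (Icc 0 1) t) = 0)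
    (hconv : ∀ᶠ z : E × E in 𝓝 (e (γ t), derivWithin (e ∘ γ) (Icc 0 1) t),
      (φ ∘ e.symm) z.1 = 0 → fderiv ℝ (φ ∘ e.symm) z.1 z.2 = 0 →
        g.chartHessian φ e z.1 z.2 ≤ 0) :
    ∀ᶠ s in 𝓝[>] t, φ (γ s) ≤ 0 := by
  have := FiniteDimensional.complete ℝ E
  have htI : t ∈ Icc (0 : ℝ) 1 := ⟨ht.1, ht.2.le⟩
  have hy := e.map_source hs
  set v : ℝ → E := derivWithin (e ∘ γ) (Icc 0 1) with hvdef
  obtain ⟨K, N, hN, hL⟩ := g.exists_lipschitzOnWith_spray he hy (v t)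
  have h0' : (φ ∘ e.symm) (e (γ t)) = 0 := by simpa [e.left_inv hs] using h0
  obtain ⟨W, hW, δ, hδ, H⟩ := exists_nhds_forall_tangent_solution_nonpos
    (contDiffAt_comp_chart_symm hφ he hy) h0' hd hv hN hL hconv
  have hsol := h.eventually_hasDerivWithinAt he htI hs
  have hsol_t := hsol.self_of_nhdsWithin htI
  have hmemW : ∀ᶠ s in 𝓝[Icc 0 1] t, ((e ∘ γ) s, v s) ∈ W :=
    (hsol_t.1.continuousWithinAt.prodMk hsol_t.2.continuousWithinAt) hW
  have hsrc : ∀ᶠ s in 𝓝[Icc 0 1] t, γ s ∈ e.source := h.1 t htI (e.open_source.mem_nhds hs)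
  obtain ⟨ε, hε, hball⟩ := Metric.mem_nhdsWithin_iff.1 (hsol.and (hmemW.and hsrc))
  have hpos : 0 < min (min ε δ) (1 - t) := lt_min (lt_min hε hδ) (sub_pos.2 ht.2)
  filter_upwards [Ioo_mem_nhdsGT (show t < t + min (min ε δ) (1 - t) by linarith)] with s hst
  set b := s - t
  have hb : b < min (min ε δ) (1 - t) := by simp only [b]; linarith [hst.2]
  have hb0 : 0 ≤ b := by simp only [b]; linarith [hst.1]
  have hbε : b < ε := hb.trans_le ((min_le_left _ _).trans (min_le_left _ _))
  have hbδ : b < δ := hb.trans_le ((min_le_left _ _).trans (min_le_right _ _))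
  have hb1 : b < 1 - t := hb.trans_le (min_le_right _ _)
  have hmaps : MapsTo (fun r : ℝ => 1 * r + t) (Icc 0 b) (Metric.ball t ε ∩ Icc 0 1) := by
    intro r hr
    refine ⟨?_, ?_, ?_⟩
    · rw [Metric.mem_ball, Real.dist_eq]
      have : 1 * r + t - t = r := by ring
      rw [this, abs_of_nonneg hr.1]
      linarith [hr.2]
    · change 0 ≤ 1 * r + t
      linarith [hr.1, ht.1]
    · change 1 * r + t ≤ 1
      linarith [hr.2]
  have hS : IsSecondOrderSol (g.spray e) (e ∘ γ) v (Metric.ball t ε ∩ Icc 0 1) := fun r hr =>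
    ⟨(hball hr).1.1.mono inter_subset_right, (hball hr).1.2.mono inter_subset_right⟩
  have hS' := hS.comp_affine (g.spray_smul e) 1 t hmaps
  have hle := H b hbδ.le _ _ hS' (fun r hr => by simpa using (hball (hmaps hr)).2.1)
    (by simpa using h0') (by simpa using hv) b ⟨hb0, le_rfl⟩
  have hbs : 1 * b + t = s := by simp only [b]; ring
  simp only [hbs, Function.comp_apply] at hle
  have hs2 : s ∈ Metric.ball t ε ∩ Icc 0 1 := hbs ▸ hmaps ⟨hb0, le_rfl⟩
  rwa [e.left_inv (hball hs2).2.2] at hle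

/-- A geodesic arc whose velocity vanishes at the time `t` is constant just after `t`. -/
theorem IsGeodesicArc.eventually_eq_of_velocity_eq_zero {γ : ℝ → M} (h : g.IsGeodesicArc γ)
    {e : OpenPartialHomeomorph M E} (he : e ∈ atlas E M) {t : ℝ} (ht : t ∈ Icc (0 : ℝ) 1)
    (hs : γ t ∈ e.source) (hv : derivWithin (e ∘ γ) (Icc 0 1) t = 0) :
    ∀ᶠ s in 𝓝[Icc 0 1] t, γ s = γ t := by
  obtain ⟨K, N, hN, hL⟩ := g.exists_lipschitzOnWith_spray he (e.map_source hs)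
    (derivWithin (e ∘ γ) (Icc 0 1) t)
  have hu := secondOrder_eventuallyEq hL ht hN (h.eventually_hasDerivWithinAt he ht hs)
    (y := fun _ => e (γ t)) (w := fun _ => 0)
    (.of_forall fun s => by
      rw [spray_zero, neg_zero]
      exact ⟨hasDerivWithinAt_const _ _ _, hasDerivWithinAt_const _ _ _⟩) rfl hv
  filter_upwards [hu, h.1 t ht (e.open_source.mem_nhds hs)] with s hs1 hs2
  exact e.injOn hs2 hs hs1.1

/-- Infinitesimal convexity forbids that a geodesic arc with the corresponding causal character
touches the boundary from inside. -/
theorem InfinitesimallyConvexOn.mem_of_isGeodesicArc {Q : ℝ → Prop} (hQo : IsOpen {r | Q r})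
    {Ω : Set M} {φ : M → ℝ} (h : g.InfinitesimallyConvexOn Q Ω φ)
    (hφ : IsC2DefiningFunction E Ω φ) {γ : ℝ → M} (hγ : g.IsGeodesicArc γ)
    (hQ : ∀ t ∈ Icc (0 : ℝ) 1, Q (g.formAt (γ t) (velocityVec γ t) (velocityVec γ t)) ∨
      (velocityVec γ t : E) = 0)
    (h0 : γ 0 ∈ Ω) (h1 : γ 1 ∈ Ω) (hcl : ∀ t ∈ Icc (0 : ℝ) 1, γ t ∈ Ω ∪ frontier Ω) :
    ∀ t ∈ Icc (0 : ℝ) 1, γ t ∈ Ω := by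
  intro t₀ ht₀
  by_contra hnot
  have hzero : φ (γ t₀) = 0 := hφ.mem_frontier_iff.1 ((hcl t₀ ht₀).resolve_left hnot)
  have hnonneg : ∀ t ∈ Icc (0 : ℝ) 1, 0 ≤ φ (γ t) := by
    intro t ht
    rcases hcl t ht with h' | h'
    · exact (hφ.pos _ h').le
    · exact (hφ.mem_frontier_iff.1 h').ge
  have hsub : Icc t₀ 1 ⊆ Icc (0 : ℝ) 1 := Icc_subset_Icc_left ht₀.1
  have hcont : ContinuousOn (fun t => φ (γ t)) (Icc t₀ 1) :=
    hφ.contMDiff.continuous.comp_continuousOn (hγ.1.mono hsub)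
  have hclosed : IsClosed ({t | φ (γ t) = 0} ∩ Icc t₀ 1) := by
    rw [inter_comm]
    exact hcont.preimage_isClosed_of_isClosed isClosed_Icc (isClosed_singleton (x := (0 : ℝ)))
  -- From `t₀` on, the contact set is closed and open to the right, so it reaches time `1`, where
  -- `φ` is positive.
  have hall : Icc t₀ 1 ⊆ {t | φ (γ t) = 0} := by
    refine hclosed.Icc_subset_of_forall_mem_nhdsWithin hzero ?_
    rintro t ⟨ht, ht1⟩
    have htz : φ (γ t) = 0 := ht
    have htI : t ∈ Icc (0 : ℝ) 1 := hsub ⟨ht1.1, ht1.2.le⟩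
    have htpos : 0 < t := by
      refine htI.1.lt_of_ne fun h' => ?_
      rw [← h'] at htz
      exact (hφ.pos _ h0).ne' htz
    set e := chartAt E (γ t)
    have he : e ∈ atlas E M := chart_mem_atlas E _
    have hs : γ t ∈ e.source := mem_chart_source E _
    have hy := e.map_source hs
    have hle : 𝓝[>] t ≤ 𝓝[Icc 0 1] t :=
      nhdsWithin_le_iff.2 (mem_of_superset (Ioc_mem_nhdsGT ht1.2)
        fun s hs => ⟨htI.1.trans hs.1.le, hs.2⟩)
    have hsol := (hγ.eventually_hasDerivWithinAt he htI hs).self_of_nhdsWithin htI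
    have hvel := hγ.velocityVec_eq he htI hs
    set w := derivWithin (e ∘ γ) (Icc 0 1) t
    have h0e : φ (e.symm (e (γ t))) = 0 := by rwa [e.left_inv hs]
    rcases hQ t htI with hQt | hvt
    -- At an interior contact time `φ ∘ γ` has a minimum, hence the contact is tangential.
    · have htan : fderiv ℝ (φ ∘ e.symm) (e (γ t)) w = 0 := by
        have hd1 : HasFDerivAt (φ ∘ e.symm) (fderiv ℝ (φ ∘ e.symm) (e (γ t))) ((e ∘ γ) t) :=
          ((contDiffAt_comp_chart_symm hφ.contMDiff he hy).differentiableAt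
            (by norm_num)).hasFDerivAt
        have hnhds : Icc (0 : ℝ) 1 ∈ 𝓝 t := Icc_mem_nhds htpos ht1.2
        have hd2 := (hd1.comp_hasDerivWithinAt t hsol.1).hasDerivAt hnhds
        refine IsLocalMin.hasDerivAt_eq_zero (f := (φ ∘ e.symm) ∘ (e ∘ γ)) ?_ hd2
        have hsrc : ∀ᶠ s in 𝓝 t, γ s ∈ e.source := by
          have := hγ.1 t htI (e.open_source.mem_nhds hs)
          rwa [nhdsWithin_eq_nhds.2 hnhds] at this
        filter_upwards [hsrc, hnhds] with s hs1 hs2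
        simp only [Function.comp_apply]
        rw [h0e, e.left_inv hs1]
        exact hnonneg s hs2
      have hQ' : Q (coordForm g.form e (e (γ t)) w w) := by
        rw [coordForm_apply, ← hvel, e.left_inv hs]
        exact hQt
      have hev := hγ.eventually_nonpos_of_tangent hφ.contMDiff he ⟨htI.1, ht1.2⟩ hs htz
        (hφ.fderiv_ne_zero he hy h0e) htan
        (h.eventually_chartHessian_nonpos hQo hφ he hy hQ')
      filter_upwards [hev, hle self_mem_nhdsWithin] with s hs1 hs2
      exact le_antisymm hs1 (hnonneg s hs2)
    · have hw0 : w = 0 := by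
        rw [hvt] at hvel
        have := chartDeriv_chartSymmDeriv he hy w
        rw [← hvel, map_zero] at this
        exact this.symm
      have hev := hγ.eventually_eq_of_velocity_eq_zero he htI hs hw0
      filter_upwards [hle hev] with s hs1
      rw [hs1, htz]
  exact (hφ.pos _ h1).ne' (hall ⟨ht₀.2, le_rfl⟩)

/-- If geodesic arcs with a given causal character cannot touch the boundary from inside, then the
boundary is infinitesimally convex in the corresponding directions. -/
theorem infinitesimallyConvexOn_of_forall_isGeodesicArc {Q : ℝ → Prop} (hQo : IsOpen {r | Q r})
    (hQs : ∀ c r : ℝ, 0 < c → Q r → Q (c * r))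
    {Ω : Set M} {φ : M → ℝ} (hφ : IsC2DefiningFunction E Ω φ)
    (H : ∀ γ : ℝ → M, g.IsGeodesicArc γ →
      (∀ t ∈ Icc (0 : ℝ) 1, Q (g.formAt (γ t) (velocityVec γ t) (velocityVec γ t))) →
      γ 0 ∈ Ω → γ 1 ∈ Ω → (∀ t ∈ Icc (0 : ℝ) 1, γ t ∈ Ω ∪ frontier Ω) →
      ∀ t ∈ Icc (0 : ℝ) 1, γ t ∈ Ω) : g.InfinitesimallyConvexOn Q Ω φ := by
  have := FiniteDimensional.complete ℝ E
  intro p hp v hv hQv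
  have hp0 := hφ.mem_frontier_iff.1 hp
  set e := chartAt E p
  have he : e ∈ atlas E M := chart_mem_atlas E p
  have hs : p ∈ e.source := mem_chart_source E p
  have hy := e.map_source hs
  have h0e : φ (e.symm (e p)) = 0 := by rwa [e.left_inv hs]
  suffices key : ∀ w : E, fderiv ℝ (φ ∘ e.symm) (e p) (chartDeriv e p w) = 0 →
      Q (g.formAt p w w) → g.chartHessian φ e (e p) (chartDeriv e p w) ≤ 0 from
    key v ((isTangentTo_iff hφ.contMDiff he hs v).1 hv) hQv
  intro w hw hQw
  by_contra! hpos
  rw [g.formAt_eq_coordForm he hs] at hQw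
  obtain ⟨U, hUe, hUo, hyU, -, -, hUΩ⟩ := hφ.exists_nhds_sides he hy h0e
  have hW : ∀ᶠ z : E × E in 𝓝 (e p, chartDeriv e p w),
      z.1 ∈ U ∧ Q (coordForm g.form e z.1 z.2 z.2) :=
    inter_mem (continuousAt_fst.preimage_mem_nhds (hUo.mem_nhds hyU))
      ((g.continuousAt_coordForm_self he hy _).preimage_mem_nhds (hQo.mem_nhds hQw))
  obtain ⟨ε, hε, x, u, hx0, hu0, hsol, hmem⟩ :=
    g.exists_solution_pos_of_chartHessian_pos hφ.contMDiff he hy h0e hw hpos hW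
  -- The contact time `0` becomes `1 / 2`. The change of time multiplies `g(γ', γ')` by `(2 * ε) ^
  -- 2`, which is why `Q` must be scaling invariant.
  have hmaps : MapsTo (fun s : ℝ => 2 * ε * s + -ε) (Icc 0 1) (Icc (-ε) ε) := by
    intro s hs
    constructor
    · change -ε ≤ 2 * ε * s + -ε
      nlinarith [hs.1]
    · change 2 * ε * s + -ε ≤ ε
      nlinarith [hs.2]
  have hsol' := hsol.comp_affine (g.spray_smul e) (2 * ε) (-ε) hmaps
  have htar : ∀ t ∈ Icc (0 : ℝ) 1, x (2 * ε * t + -ε) ∈ e.target := fun t ht =>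
    hUe (hmem _ (hmaps ht)).1.1
  obtain ⟨harc, hvel⟩ := isGeodesicArc_of_isSecondOrderSol he hsol' htar
  set γ : ℝ → M := e.symm ∘ fun s => x (2 * ε * s + -ε) with hγ
  have hΩ : ∀ t ∈ Icc (0 : ℝ) 1, 2 * ε * t + -ε ≠ 0 → γ t ∈ Ω := fun t ht hne =>
    hUΩ _ (hmem _ (hmaps ht)).1.1 ((hmem _ (hmaps ht)).2 hne)
  have hhalf : γ (1 / 2) = p := by
    have : 2 * ε * (1 / 2) + -ε = 0 := by ring
    simp only [γ, Function.comp_apply]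
    rw [this, hx0, e.left_inv hs]
  have hin : γ (1 / 2) ∈ Ω := by
    refine H γ harc ?_ (hΩ 0 (by simp) (by simpa using hε.ne')) (hΩ 1 (by simp) ?_) ?_ _
      ⟨by norm_num, by norm_num⟩
    · intro t ht
      rw [hvel t ht]
      change Q (coordForm g.form e (x (2 * ε * t + -ε)) ((2 * ε) • u (2 * ε * t + -ε))
        ((2 * ε) • u (2 * ε * t + -ε)))
      rw [map_smul, map_smul, smul_apply, smul_eq_mul, smul_eq_mul, ← mul_assoc]
      exact hQs _ _ (by positivity) (hmem _ (hmaps ht)).1.2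
    · intro h
      linarith
    · intro t ht
      by_cases hne : 2 * ε * t + -ε = 0
      · right
        have : t = 1 / 2 := by
          have : ε * (2 * t - 1) = 0 := by linarith
          rcases mul_eq_zero.1 this with h | h <;> linarith
        rw [this, hhalf]
        exact hp
      · exact Or.inl (hΩ t ht hne)
  rw [hhalf] at hin
  exact (hφ.pos p hin).ne' hp0

omit [IsManifold 𝓘(ℝ, E) 2 M] [FiniteDimensional ℝ E] in
theorem infinitesimallyConvexOn_true_iff {Ω : Set M} {φ : M → ℝ} :
    g.InfinitesimallyConvexOn (fun _ => True) Ω φ ↔ g.InfinitesimallyConvex Ω φ :=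
  ⟨fun h p hp v hv => h p hp v hv trivial, fun h p hp v hv _ => h p hp v hv⟩

/-- If the Hessian were positive on a tangent `w`, the solution in the chart would bring `exp_p (c •
w)` into `Ω` for small `c > 0`. Uniqueness of geodesics identifies it with the geodesic supplied by
local convexity. -/
theorem LocallyConvex.infinitesimallyConvex [T2Space M] {Ω : Set M} {φ : M → ℝ}
    (h : g.LocallyConvex Ω φ) (hφ : IsC2DefiningFunction E Ω φ) :
    g.InfinitesimallyConvex Ω φ := by
  have := FiniteDimensional.complete ℝ E
  intro p hp v hv
  have hp0 := hφ.mem_frontier_iff.1 hp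
  obtain ⟨V, -, -, -, -, O, hO, hexp⟩ := h p hp
  set e := chartAt E p
  have he : e ∈ atlas E M := chart_mem_atlas E p
  have hs : p ∈ e.source := mem_chart_source E p
  have hy := e.map_source hs
  have h0e : φ (e.symm (e p)) = 0 := by rwa [e.left_inv hs]
  suffices key : ∀ w : E, fderiv ℝ (φ ∘ e.symm) (e p) (chartDeriv e p w) = 0 →
      g.chartHessian φ e (e p) (chartDeriv e p w) ≤ 0 from
    key v ((isTangentTo_iff hφ.contMDiff he hs v).1 hv)
  intro w hw
  by_contra! hpos
  obtain ⟨U, hUe, hUo, hyU, -, -, hUΩ⟩ := hφ.exists_nhds_sides he hy h0e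
  have hW : Prod.fst ⁻¹' U ∈ 𝓝 (e p, chartDeriv e p w) :=
    continuousAt_fst.preimage_mem_nhds (hUo.mem_nhds hyU)
  obtain ⟨ε, hε, x, u, hx0, hu0, hsol, hmem⟩ :=
    g.exists_solution_pos_of_chartHessian_pos hφ.contMDiff he hy h0e hw hpos hW
  have hO' : ∀ᶠ c : ℝ in 𝓝 0, (c • w : E) ∈ (O : Set E) := by
    have hc : ContinuousAt (fun c : ℝ => c • w) 0 := by fun_prop
    refine hc.preimage_mem_nhds ?_
    rw [zero_smul]
    exact hO
  obtain ⟨c, hcO, hc0, hcε⟩ : ∃ c : ℝ, (c • w : E) ∈ (O : Set E) ∧ c ∈ Ioo 0 ε :=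
    ((hO'.filter_mono nhdsWithin_le_nhds).and (Ioo_mem_nhdsGT hε)).exists
  have htan : IsTangentTo E φ p (c • w : E) := by
    refine (isTangentTo_iff hφ.contMDiff he hs _).2 ?_
    rw [map_smul, map_smul, hw, smul_zero]
  obtain ⟨q, hqU, σ, hσ, hσ0, hσ1⟩ := hexp _ hcO htan
  obtain ⟨hσp, hσv⟩ := totalSpace_velocity_eq_iff.1 hσ0
  have hmaps : MapsTo (fun s : ℝ => c * s + 0) (Icc 0 1) (Icc (-ε) ε) := by
    intro s hs
    constructor
    · change -ε ≤ c * s + 0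
      nlinarith [hs.1]
    · change c * s + 0 ≤ ε
      nlinarith [hs.2]
  have hsol' := hsol.comp_affine (g.spray_smul e) c 0 hmaps
  obtain ⟨harc, hvel⟩ := isGeodesicArc_of_isSecondOrderSol he hsol'
    fun t ht => hUe (hmem _ (hmaps ht)).1
  have h0I : (0 : ℝ) ∈ Icc (0 : ℝ) 1 := by simp
  have h1I : (1 : ℝ) ∈ Icc (0 : ℝ) 1 := by simp
  have hend := hσ.eqOn harc (by simp [hσp, hx0, e.left_inv hs]) (by
    rw [hσv, hvel 0 h0I]
    simp only [mul_zero, add_zero, hx0, hu0, map_smul]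
    rw [chartSymmDeriv_chartDeriv he hs]) h1I
  refine hqU.2 ?_
  rw [← hσ1, hend]
  exact hUΩ _ (hmem _ (hmaps h1I)).1 ((hmem _ (hmaps h1I)).2 (by simpa using hc0.ne'))

/-- The tangency estimate is applied at `(p, 0)`, a point of phase space near which all small
tangent vectors are treated uniformly. -/
theorem InfinitesimallyConvex.locallyConvex {Ω : Set M} {φ : M → ℝ}
    (h : g.InfinitesimallyConvex Ω φ) (hφ : IsC2DefiningFunction E Ω φ) :
    g.LocallyConvex Ω φ := by
  have := FiniteDimensional.complete ℝ E
  intro p hp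
  have hp0 := hφ.mem_frontier_iff.1 hp
  set e := chartAt E p
  have he : e ∈ atlas E M := chart_mem_atlas E p
  have hs : p ∈ e.source := mem_chart_source E p
  have hy := e.map_source hs
  have h0e : φ (e.symm (e p)) = 0 := by rwa [e.left_inv hs]
  obtain ⟨U, hUe, hUo, hyU, hUpos, hUneg, hUΩ⟩ := hφ.exists_nhds_sides he hy h0e
  have hpos : e.symm '' U ∩ Ω = e.symm '' {z ∈ U | 0 < φ (e.symm z)} := by
    ext q
    constructor
    · rintro ⟨⟨z, hz, rfl⟩, hq⟩
      exact ⟨z, ⟨hz, hφ.pos _ hq⟩, rfl⟩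
    · rintro ⟨z, hz, rfl⟩
      exact ⟨⟨z, hz.1, rfl⟩, hUΩ z hz.1 hz.2⟩
  have hneg : e.symm '' U \ closure Ω = e.symm '' {z ∈ U | φ (e.symm z) < 0} := by
    ext q
    constructor
    · rintro ⟨⟨z, hz, rfl⟩, hq⟩
      refine ⟨z, ⟨hz, ?_⟩, rfl⟩
      by_contra! hge
      refine hq ?_
      rcases hge.eq_or_lt with h' | h'
      · exact frontier_subset_closure (hφ.mem_frontier_iff.2 h'.symm)
      · exact subset_closure (hUΩ z hz h')
    · rintro ⟨z, hz, rfl⟩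
      exact ⟨⟨z, hz.1, rfl⟩, hφ.notMem_closure hz.2⟩
  have hUc : ContinuousOn e.symm U := e.symm.continuousOn.mono hUe
  refine ⟨e.symm '' U, e.symm.isOpen_image_of_subset_source hUo hUe,
    ⟨e p, hyU, e.left_inv hs⟩, ?_, ?_, ?_⟩
  · rw [hpos]
    exact hUpos.image _ (hUc.mono fun z hz => hz.1)
  · rw [hneg]
    exact hUneg.image _ (hUc.mono fun z hz => hz.1)
  obtain ⟨K, N, hN, hL⟩ := g.exists_lipschitzOnWith_spray he hy 0
  have hconv := (infinitesimallyConvexOn_true_iff.2 h).eventually_chartHessian_nonpos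
    (w := 0) (by simp) hφ he hy trivial
  obtain ⟨W, hW, δ, hδ, H⟩ := exists_nhds_forall_tangent_solution_nonpos
    (contDiffAt_comp_chart_symm hφ.contMDiff he hy) h0e (hφ.fderiv_ne_zero he hy h0e)
    (map_zero _) hN hL hconv
  have hWU : W ∩ Prod.fst ⁻¹' U ∈ 𝓝 (e p, (0 : E)) :=
    inter_mem hW (continuousAt_fst.preimage_mem_nhds (hUo.mem_nhds hyU))
  obtain ⟨ε, hε, hεδ, r, hr, hex⟩ := exists_secondOrderSol_mem hN hL hWU hδ
  -- The geodesic with initial velocity `w` on `[0, 1]` is the one with velocity `ε⁻¹ • w` run for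
  -- time `ε`; the bound `r * ε` puts the latter among the admissible initial data.
  have hO : {w : E | ‖chartDeriv e p w‖ < r * ε} ∈ 𝓝 (0 : E) := by
    have hc : Continuous fun w : E => ‖chartDeriv e p w‖ := (chartDeriv e p).continuous.norm
    refine (isOpen_lt hc continuous_const).mem_nhds ?_
    simp only [mem_ofPred_eq, map_zero, norm_zero]
    positivity
  refine ⟨{w : E | ‖chartDeriv e p w‖ < r * ε}, hO, fun v hvO hv => ?_⟩
  suffices key : ∀ w : E, fderiv ℝ (φ ∘ e.symm) (e p) (chartDeriv e p w) = 0 →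
      ‖chartDeriv e p w‖ < r * ε → ∃ q ∈ e.symm '' U \ Ω, g.IsExp p w q from
    key v ((isTangentTo_iff hφ.contMDiff he hs v).1 hv) hvO
  intro w hw hwr
  set w' := chartDeriv e p w with hw'
  obtain ⟨x, u, hx0, hu0, hsol, hmem⟩ := hex (e p, ε⁻¹ • w') (by
    rw [mem_closedBall_iff_norm]
    simp only [Prod.mk_sub_mk, sub_self, sub_zero, Prod.norm_mk, norm_zero, norm_smul, norm_inv,
      Real.norm_eq_abs, abs_of_pos hε]
    refine max_le hr.le ?_
    rw [inv_mul_le_iff₀ hε, mul_comm]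
    exact hwr.le)
  have hsub : Icc 0 ε ⊆ Icc (-ε) ε := Icc_subset_Icc_left (by linarith)
  have hle := H ε hεδ x u (hsol.mono hsub) (fun t ht => (hmem t (hsub ht)).1)
    (by rw [hx0]; exact h0e) (by rw [hx0, hu0, map_smul, hw, smul_zero]) ε ⟨hε.le, le_rfl⟩
  have hmaps : MapsTo (fun s : ℝ => ε * s + 0) (Icc 0 1) (Icc (-ε) ε) := by
    intro s hs
    constructor
    · change -ε ≤ ε * s + 0
      nlinarith [hs.1]
    · change ε * s + 0 ≤ ε
      nlinarith [hs.2]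
  have hsol' := hsol.comp_affine (g.spray_smul e) ε 0 hmaps
  obtain ⟨harc, hvel⟩ := isGeodesicArc_of_isSecondOrderSol he hsol'
    fun t ht => hUe (hmem _ (hmaps ht)).2
  refine ⟨e.symm (x ε), ⟨⟨x ε, (hmem ε ⟨by linarith, le_rfl⟩).2, rfl⟩, fun hq => ?_⟩, _, harc,
    totalSpace_velocity_eq_iff.2 ⟨?_, ?_⟩, ?_⟩
  · exact absurd (hφ.pos _ hq) (not_lt.2 hle)
  · simp [hx0, e.left_inv hs]
  · rw [hvel 0 (by simp)]
    simp only [mul_zero, add_zero, hx0, hu0]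
    rw [smul_smul, mul_inv_cancel₀ hε.ne', one_smul, hw', chartSymmDeriv_chartDeriv he hs]
  · simp

end SemiRiemannianMetric

theorem corollary4p1 {E : Type*} [NormedAddCommGroup E] [NormedSpace ℝ E] [FiniteDimensional ℝ E]
    {M : Type*} [TopologicalSpace M] [T2Space M] [ChartedSpace E M] [IsManifold 𝓘(ℝ, E) 2 M]
    (g : SemiRiemannianMetric E M) (Ω : Set M) (φ : M → ℝ) (hφ : IsC2DefiningFunction E Ω φ) :
    (g.LocallyConvex Ω φ ↔ g.InfinitesimallyConvex Ω φ) ∧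
    (g.InfinitesimallyConvex Ω φ ↔ g.GeometricallyConvex Ω) ∧
    (g.TimeInfinitesimallyConvex Ω φ ↔ g.TimeGeometricallyConvex Ω) ∧
    (g.SpaceInfinitesimallyConvex Ω φ ↔ g.SpaceGeometricallyConvex Ω) := by
  refine ⟨⟨fun h => h.infinitesimallyConvex hφ, fun h => h.locallyConvex hφ⟩,
    ⟨fun h γ hγ h0 h1 hcl => ?_, fun h => ?_⟩, ⟨fun h γ hγ hQ h0 h1 hcl => ?_, fun h => ?_⟩,
    ⟨fun h γ hγ hQ h0 h1 hcl => ?_, fun h => ?_⟩⟩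
  · exact (SemiRiemannianMetric.infinitesimallyConvexOn_true_iff.2 h).mem_of_isGeodesicArc
      (by simp) hφ hγ (fun _ _ => Or.inl trivial) h0 h1 hcl
  · refine SemiRiemannianMetric.infinitesimallyConvexOn_true_iff.1 ?_
    exact SemiRiemannianMetric.infinitesimallyConvexOn_of_forall_isGeodesicArc (by simp)
      (fun _ _ _ _ => trivial) hφ fun γ hγ _ h0 h1 hcl => h γ hγ h0 h1 hcl
  · have h' : g.InfinitesimallyConvexOn (fun r => r < 0) Ω φ := h
    exact h'.mem_of_isGeodesicArc isOpen_Iio hφ hγ (fun t ht => Or.inl (hQ t ht)) h0 h1 hcl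
  · exact SemiRiemannianMetric.infinitesimallyConvexOn_of_forall_isGeodesicArc
      (Q := fun r => r < 0) isOpen_Iio (fun c r hc hr => mul_neg_of_pos_of_neg hc hr) hφ
      fun γ hγ hQ h0 h1 hcl => h γ hγ hQ h0 h1 hcl
  -- Being spacelike is not an open condition, as it includes `v = 0`. The condition `0 < r` is
  -- open, and zero velocity is the separate alternative in `mem_of_isGeodesicArc`.
  · have h' : g.InfinitesimallyConvexOn (fun r => 0 < r) Ω φ :=
      fun p hp v hv hQ => h p hp v hv (Or.inl hQ)
    exact h'.mem_of_isGeodesicArc isOpen_Ioi hφ hγ (fun t ht => hQ t ht) h0 h1 hcl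
  · have h' : g.InfinitesimallyConvexOn (fun r => 0 < r) Ω φ :=
      SemiRiemannianMetric.infinitesimallyConvexOn_of_forall_isGeodesicArc isOpen_Ioi
        (fun c r hc hr => mul_pos hc hr) hφ
        fun γ hγ hQ h0 h1 hcl => h γ hγ (fun t ht => Or.inl (hQ t ht)) h0 h1 hcl
    -- The remaining vector `v = 0` satisfies the inequality because the Hessian vanishes there.
    intro p hp v hv hv'
    rcases hv' with hpos | rfl
    · exact h' p hp v hv hpos
    · rw [SemiRiemannianMetric.hessian_self]
      have h0 : g.chartHessian φ (chartAt E p) (chartAt E p p)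
          (chartDeriv (chartAt E p) p (0 : E)) = 0 := by
        rw [map_zero, SemiRiemannianMetric.chartHessian_zero]
      exact h0.le
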